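/- Let $q\ge 2$ and $\Sigma=\{0,\dots,q-1\}$. Let $\mathcal F=\{a_1,\dots,a_s\}$ be a non-empty finite set of words over $\Sigma$, each of length at least $2$, and let $\Sigma_{\mathcal F}\subseteq\Sigma^{\mathbb N}$ be the set of one-sided sequences in which no $a_i$ appears. A word is *allowed* if it appears in some sequence of $\Sigma_{\mathcal F}$. Assume that $\mathcal F$ is minimal, i.e. every proper subword of each $a_i$ is allowed. Let $p\ge 2$ be the length of the longest word in $\mathcal F$, and let $A$ be the $(0,1)$ adjacency matrix indexed by the allowed words of length $p-1$, with $A_{xy}=1$ iff $x_2\cdots x_{p-1}=y_1\cdots y_{p-2}$ and $x_1\cdots x_{p-1}y_{p-1}$ is allowed. Assume that $A$ is irreducible, i.e. for all $x,y$ there is $\ell\ge 1$ with $(A^\ell)_{xy}>0$. Let $\theta$ be its Perron root (spectral radius). For words $x,y$ with $|x|=p_1$ put $(x,y)_z=\sum_{\ell=0}^{p_1-1}b_\ell z^{p_1-1-\ell}$, where $b_\ell=1$ if the overlapping parts of $x$ and $y$ are identical when the first symbol of $y$ is placed below the $(\ell+1)$-th symbol of $x$, and $b_\ell=0$ otherwise.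 Let $\mathcal M(z)=[(a_j,a_i)_z]_{1\le i,j\le s}$, let $\mathcal D(z)$ be its determinant and $\mathcal S(z)$ the sum of the entries of its adjugate, and let $\mathcal R_i(z)$ and $\mathcal C_j(z)$ be the sums of the entries of the $i$-th row and of the $j$-th column of $\mathcal M(z)^{-1}$. For an allowed word $w$ of length at least $p$, let $\mathcal D_w(z)$ and $\mathcal S_w(z)$ be the analogous quantities for the collection $\mathcal F\cup\{w\}$. Then the following hold. 1. The limits $\mathcal R_i(\theta):=\lim_{z\to\theta}\mathcal R_i(z)$ and $\mathcal C_j(\theta):=\lim_{z\to\theta}\mathcal C_j(z)$ exist and are real for all $i,j$. For a word $x$ of length $p-1$ put $$u_x=1-\sum_{i=1}^s\mathcal R_i(\theta)\,(\widetilde{a_i},x)_\theta,\qquad v_x=1-\sum_{j=1}^s\mathcal C_j(\theta)\,(x,a_j)_\theta,$$ where $\widetilde{a_i}$ is $a_i$ without its first symbol. 2. For every allowed word $w$ of length at least $p$ that starts with the word $x$ and ends with the word $y$, both of length $p-1$, $$\lim_{z\to\theta}\frac{\mathcal D(z)\mathcal S_w(z)-\mathcal S(z)\mathcal D_w(z)}{\mathcal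 D(z)^2}=u_xv_y>0 .$$ 3. Consequently all the numbers $u_x,v_x$, for $x$ an allowed word of length $p-1$, are nonzero and have the same sign; in particular $u_xv_x>0$ for every such $x$. Here $z$ tends to $\theta$ through complex values $z\ne\theta$. -/

import Mathlib

open Filter Topology Polynomial

namespace ForbiddenWords

/-- The word `w` appears in the one-sided sequence `ξ` (at some position `k`). -/
def AppearsIn {q : ℕ} (w : List (Fin q)) (ξ : ℕ → Fin q) : Prop :=
  ∃ k : ℕ, ∀ j : Fin w.length, ξ (k + j) = w.get j

/-- The subshift of finite type with forbidden words `a i`: all one-sided sequences over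
`Fin q = {0, …, q - 1}` in which none of the words `a i` appears. -/
def subshift {q : ℕ} {ι : Type*} (a : ι → List (Fin q)) : Set (ℕ → Fin q) :=
  {ξ | ∀ i, ¬ AppearsIn (a i) ξ}

/-- A word is allowed if it appears in some sequence of the subshift. -/
def IsAllowed {q : ℕ} {ι : Type*} (a : ι → List (Fin q)) (w : List (Fin q)) : Prop :=
  ∃ ξ ∈ subshift a, AppearsIn w ξ

/-- The family `a` lists, without repetition, a minimal collection of forbidden words, none of
which is a single symbol (or empty): every proper subword of a forbidden word is allowed. -/
structure IsMinimal {q : ℕ} {ι : Type*} (a : ι → List (Fin q)) : Prop where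
  injective : Function.Injective a
  two_le_length : ∀ i, 2 ≤ (a i).length
  allowed_of_proper_subword : ∀ i, ∀ w : List (Fin q), w <:+: a i → w ≠ a i → IsAllowed a w

/-- Allowed words of length `m`. -/
abbrev AllowedWord {q : ℕ} {ι : Type*} (a : ι → List (Fin q)) (m : ℕ) : Type :=
  {x : List.Vector (Fin q) m // IsAllowed a x.toList}

noncomputable instance instFintypeAllowedWord {q : ℕ} {ι : Type*} (a : ι → List (Fin q)) (m : ℕ) :
    Fintype (AllowedWord a m) := Fintype.ofFinite _

open Classical in
/-- The adjacency matrix, indexed by the allowed words of length `p - 1`: the entry at `x, y` is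
`1` iff, for some symbol `β`, `y` is `x` with its first symbol removed and `β` appended, and the
word `xβ` of length `p` is allowed; all other entries are `0`. -/
noncomputable def adjacencyMatrix {q : ℕ} {ι : Type*} (a : ι → List (Fin q)) (p : ℕ) :
    Matrix (AllowedWord a (p - 1)) (AllowedWord a (p - 1)) ℝ :=
  Matrix.of fun x y =>
    if ∃ β : Fin q, y.1.toList = x.1.toList.tail ++ [β] ∧ IsAllowed a (x.1.toList ++ [β])
    then 1 else 0

/-- The Perron root `θ`: the spectral radius (over `ℂ`) of the adjacency matrix. -/
noncomputable def perronRoot {q : ℕ} {ι : Type*} (a : ι → List (Fin q)) (p : ℕ) : ℝ :=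
  (spectralRadius ℂ ((adjacencyMatrix a p).map (fun t : ℝ => (t : ℂ)))).toReal

/-- The correlation polynomial `(x, y)_z`. The coefficient `b_ℓ` is `1` iff the overlapping parts
of `x` and `y` agree when the first symbol of `y` is placed below the `(ℓ + 1)`-th symbol of `x`,
that is, iff one of `x.drop ℓ` and `y` is a prefix of the other. -/
noncomputable def corr {q : ℕ} (x y : List (Fin q)) : ℤ[X] :=
  ∑ l ∈ Finset.range x.length,
    if x.drop l <+: y ∨ y <+: x.drop l then X ^ (x.length - 1 - l) else 0

/-- The correlation matrix `𝓜(z)`, with entry `(a j, a i)_z` in row `i` and column `j`. -/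
noncomputable def corrMatrix {q : ℕ} {ι : Type*} (a : ι → List (Fin q)) : Matrix ι ι ℤ[X] :=
  Matrix.of fun i j => corr (a j) (a i)

/-- `𝓓(z)`, the determinant of the correlation matrix. -/
noncomputable def corrDet {q : ℕ} {ι : Type*} [Fintype ι] [DecidableEq ι]
    (a : ι → List (Fin q)) : ℤ[X] :=
  (corrMatrix a).det

/-- `𝓢(z)`, the sum of the entries of the adjugate of the correlation matrix. -/
noncomputable def corrAdjSum {q : ℕ} {ι : Type*} [Fintype ι] [DecidableEq ι]
    (a : ι → List (Fin q)) : ℤ[X] :=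
  ∑ i, ∑ j, (corrMatrix a).adjugate i j

/-- The family of words that extends `a` by the word `w`. -/
def adjoin {q : ℕ} {ι : Type*} (a : ι → List (Fin q)) (w : List (Fin q)) :
    ι ⊕ Unit → List (Fin q) :=
  Sum.elim a fun _ => w

/-- `𝓡_i(z)`, the sum of the entries of the `i`-th row of `𝓜(z)⁻¹`. -/
noncomputable def rowSum {q : ℕ} {ι : Type*} [Fintype ι] [DecidableEq ι]
    {K : Type*} [Field K] (a : ι → List (Fin q)) (i : ι) (z : K) : K :=
  ∑ j, ((corrMatrix a).map fun f => aeval z f)⁻¹ i j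

/-- `𝓒_j(z)`, the sum of the entries of the `j`-th column of `𝓜(z)⁻¹`. -/
noncomputable def colSum {q : ℕ} {ι : Type*} [Fintype ι] [DecidableEq ι]
    {K : Type*} [Field K] (a : ι → List (Fin q)) (j : ι) (z : K) : K :=
  ∑ i, ((corrMatrix a).map fun f => aeval z f)⁻¹ i j

/-- `𝓡_i(θ)`, the limit of `𝓡_i(z)` as `z` tends to `θ`. -/
noncomputable def rowSumLim {q : ℕ} {ι : Type*} [Fintype ι] [DecidableEq ι]
    (a : ι → List (Fin q)) (θ : ℝ) (i : ι) : ℝ :=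
  limUnder (𝓝[≠] θ) fun z : ℝ => rowSum a i z

/-- `𝓒_j(θ)`, the limit of `𝓒_j(z)` as `z` tends to `θ`. -/
noncomputable def colSumLim {q : ℕ} {ι : Type*} [Fintype ι] [DecidableEq ι]
    (a : ι → List (Fin q)) (θ : ℝ) (j : ι) : ℝ :=
  limUnder (𝓝[≠] θ) fun z : ℝ => colSum a j z

/-- `u_x = 1 - ∑ i, 𝓡_i(θ) (ã_i, x)_θ`, where `ã_i` is `a i` without its first symbol. -/
noncomputable def uVec {q : ℕ} {ι : Type*} [Fintype ι] [DecidableEq ι]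
    (a : ι → List (Fin q)) (θ : ℝ) (x : List (Fin q)) : ℝ :=
  1 - ∑ i, rowSumLim a θ i * aeval θ (corr (a i).tail x)

/-- `v_x = 1 - ∑ j, 𝓒_j(θ) (x, a_j)_θ`. -/
noncomputable def vVec {q : ℕ} {ι : Type*} [Fintype ι] [DecidableEq ι]
    (a : ι → List (Fin q)) (θ : ℝ) (x : List (Fin q)) : ℝ :=
  1 - ∑ j, colSumLim a θ j * aeval θ (corr x (a j))

/-- Every subword of an allowed word is allowed. -/
theorem IsAllowed.of_infix {q : ℕ} {ι : Type*} {a : ι → List (Fin q)} {v w : List (Fin q)}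
    (hw : IsAllowed a w) (h : v <:+: w) : IsAllowed a v := by
  obtain ⟨ξ, hξ, k, hk⟩ := hw
  obtain ⟨s, t, rfl⟩ := h
  refine ⟨ξ, hξ, k + s.length, fun j => ?_⟩
  have h1 := hk ⟨s.length + j, by simp; omega⟩
  simp only [List.get_eq_getElem] at h1 ⊢
  rw [show k + s.length + (j : ℕ) = k + (s.length + j) by omega, h1]
  rw [List.getElem_append_left (by simp), List.getElem_append_right (by simp)]
  simp

/-- For a minimal collection, the allowed words are exactly the words that contain no forbidden
word as a subword. -/
theorem IsMinimal.isAllowed_iff {q : ℕ} (hq : 0 < q) {ι : Type*} {a : ι → List (Fin q)}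
    (ha : IsMinimal a) (w : List (Fin q)) : IsAllowed a w ↔ ∀ i, ¬ a i <:+: w := by
  classical
  refine ⟨fun h i hi => ?_, fun hw => ?_⟩
  · obtain ⟨ξ, hξ, hk⟩ := h.of_infix hi
    exact hξ i hk
  -- every word without forbidden subwords can be extended to the right
  have ext : ∀ w : List (Fin q), (∀ i, ¬ a i <:+: w) →
      ∃ β, ∀ i, ¬ a i <:+: w ++ [β] := by
    intro w hw
    by_contra! hcon
    have key : ∀ β, ∃ i c, c <:+ w ∧ a i = c ++ [β] := by
      intro β
      obtain ⟨i, hi⟩ := hcon β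
      rw [List.infix_concat_iff] at hi
      rcases hi with hi | hi
      · rcases List.suffix_concat_iff.mp hi with h0 | ⟨c, hc, hcw⟩
        · have := ha.two_le_length i
          simp [h0] at this
        · exact ⟨i, c, hcw, hc⟩
      · exact absurd hi (hw i)
    choose i c hc hi using key
    have : Nonempty (Fin q) := ⟨⟨0, hq⟩⟩
    obtain ⟨β, hβ⟩ := Finite.exists_max fun β => (c β).length
    have hall : IsAllowed a (c β) := ha.allowed_of_proper_subword (i β) _
      (by rw [hi]; exact (List.prefix_append _ _).isInfix)
      (by rw [hi]; intro h; simpa using congrArg List.length h)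
    obtain ⟨ξ, hξ, k, hk⟩ := hall
    set γ := ξ (k + (c β).length) with hγ
    have h1 : IsAllowed a (c β ++ [γ]) := by
      refine ⟨ξ, hξ, k, fun j => ?_⟩
      rcases lt_or_ge (j : ℕ) (c β).length with hj | hj
      · have := hk ⟨j, hj⟩
        simp only [List.get_eq_getElem] at this ⊢
        rw [this, List.getElem_append_left hj]
      · have hj2 : (j : ℕ) = (c β).length := by
          have := j.2
          simp at this
          omega
        simp [hj2, hγ]
    have h2 : a (i γ) <:+: c β ++ [γ] := by
      rw [hi]
      obtain ⟨t, ht⟩ := List.suffix_of_suffix_length_le (hc γ) (hc β) (hβ γ)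
      exact ⟨t, [], by simp [← ht]⟩
    obtain ⟨ξ', hξ', hk'⟩ := h1.of_infix h2
    exact hξ' _ hk'
  have : Nonempty (Fin q) := ⟨⟨0, hq⟩⟩
  choose! f hf using ext
  obtain ⟨g, g0, gs⟩ : ∃ g : ℕ → List (Fin q), g 0 = w ∧ ∀ n, g (n + 1) = g n ++ [f (g n)] :=
    ⟨fun n => Nat.rec w (fun _ v => v ++ [f v]) n, rfl, fun _ => rfl⟩
  have gok : ∀ n i, ¬ a i <:+: g n := by
    intro n
    induction n with
    | zero => rw [g0]; exact hw
    | succ n ih => rw [gs]; exact hf _ ih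
  have glen : ∀ n, (g n).length = w.length + n := by
    intro n
    induction n with
    | zero => simp [g0]
    | succ n ih => rw [gs]; simp [ih]; omega
  have gpre : ∀ m n, g m <+: g (m + n) := by
    intro m n
    induction n with
    | zero => exact List.prefix_refl _
    | succ n ih =>
      rw [← Nat.add_assoc, gs]
      exact ih.trans (List.prefix_append _ _)
  let ξ : ℕ → Fin q := fun n => (g (n + 1))[n]'(by rw [glen]; omega)
  have hξ : ∀ n j (h : j < (g n).length), ξ j = (g n)[j] := by
    intro n j h
    have h3 : j < (g (j + 1)).length := by rw [glen]; omega
    rcases le_total (j + 1) n with hn | hn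
    · obtain ⟨d, rfl⟩ := Nat.exists_eq_add_of_le hn
      exact (gpre (j + 1) d).getElem h3
    · obtain ⟨d, hd⟩ := Nat.exists_eq_add_of_le hn
      have h4 := gpre n d
      rw [← hd] at h4
      exact (h4.getElem h).symm
  refine ⟨ξ, fun i hi => ?_, 0, fun j => ?_⟩
  · obtain ⟨k, hk⟩ := hi
    refine gok (k + (a i).length) i ?_
    have : a i = ((g (k + (a i).length)).drop k).take (a i).length := by
      apply List.ext_getElem
      · simp [glen]; omega
      · intro j h5 h6
        have := hk ⟨j, h5⟩
        simp only [List.get_eq_getElem] at this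
        rw [← this, hξ (k + (a i).length) (k + j) (by rw [glen]; omega)]
        simp
    have h7 := (List.take_prefix (a i).length ((g (k + (a i).length)).drop k)).isInfix.trans
      (List.drop_suffix k (g (k + (a i).length))).isInfix
    rwa [← this] at h7
  · rw [Nat.zero_add, hξ 0 j (by rw [g0]; exact j.2)]
    simp [g0]

end ForbiddenWords

open ForbiddenWords

/-! For `z > θ`, weight a word of length `n` by `z⁻¹ ^ n`. Let `F` be the sum over all avoiding
words, `F_x` the sum over the `v` with `v ++ x` avoiding, and `H_j` the sum over the words whose
first forbidden subword is the suffix `a j`. Writing `x` letter by letter after an avoiding `v` and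
recording when a forbidden word is first completed gives `F = F_x + ∑ j, z (a_j, x)_z H_j`
(`wordSeries_nil_eq`). For `x = a i` the term `F_x` vanishes, so `𝓜(z)` maps the vector `z H` to the
constant vector `F`. Where `𝓓(z) ≠ 0` this means `𝓡_j F = z H_j`, and then `1 - ∑ j, 𝓡_j (a_j, x)_z
= F_x / F` for avoiding `x`.

Deleting a last letter shows `z H_j ≤ F`, so the rational function `𝓡_j` is bounded to the right of
`θ` and has no pole there. Irreducibility joins every avoiding word to `x` by one of finitely many
connecting words, so `F ≤ C F_x` with `C` uniform near `θ`, and the limit `u_x` is at least `1 / C`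
(`exists_rowSum_limit`). Reversing all words transposes `𝓜` and yields `v_y > 0`; the common sign is
therefore plus.

The quotient in the theorem factors before any limit is taken: a Schur complement
(`bordered_adjugate_sum`) turns it into the product of the expressions for `u` and `v` with `w` in
both places. A proper overlap of `w` with a forbidden word has at most `p - 1` letters, so only the
prefix `x` and the suffix `y` of `w` matter. -/

namespace ForbiddenWords

/-! ### Avoiding words, first hits and overlap polynomials. -/

section

variable {q : ℕ} {ι : Type*}

/-- The word `w` contains none of the words `a i` as a subword. -/
def Avoids (a : ι → List (Fin q)) (w : List (Fin q)) : Prop := ∀ i, ¬ a i <:+: w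

/-- The word `w` ends with `a j`, and none of the words `a i` occurs before its last symbol. -/
def FirstHit (a : ι → List (Fin q)) (j : ι) (w : List (Fin q)) : Prop :=
  a j <:+ w ∧ Avoids a w.dropLast

theorem Avoids.of_infix {a : ι → List (Fin q)} {v w : List (Fin q)} (hw : Avoids a w)
    (h : v <:+: w) : Avoids a v := fun i hi => hw i (hi.trans h)

/-- Two avoiding words glue along a common part `y` that is long enough. -/
theorem Avoids.glue {a : ι → List (Fin q)} {u y r : List (Fin q)} {m : ℕ}
    (hlen : ∀ i, (a i).length ≤ m + 1) (hu : Avoids a (u ++ y)) (hr : Avoids a (y ++ r))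
    (hy : m ≤ y.length) : Avoids a (u ++ y ++ r) := by
  intro i hi
  rw [List.append_assoc] at hi
  rcases List.infix_append_iff.mp hi with h | h | ⟨l₁, l₂, h, h₁, h₂⟩
  · exact hu i (h.trans List.infix_append_left)
  · exact hr i h
  · have hl := hlen i
    rw [h, List.length_append] at hl
    rcases Nat.eq_zero_or_pos l₁.length with h0 | h0
    · rw [List.length_eq_zero_iff.mp h0, List.nil_append] at h
      exact hr i (h ▸ h₂.isInfix)
    -- At least one of the at most `m + 1` letters lies in `u`, so the remaining ones fit inside
    -- `y`.
    · have h₃ : l₂ <+: y :=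
        List.prefix_of_prefix_length_le h₂ (List.prefix_append _ _) (by omega)
      obtain ⟨s, rfl⟩ := h₁
      obtain ⟨s', rfl⟩ := h₃
      exact hu i ⟨s, s', by rw [h]; simp⟩

theorem firstHit_unique {a : ι → List (Fin q)} (hanti : ∀ i j, a i <:+: a j → i = j)
    {i j : ι} {w : List (Fin q)} (hi : a i <:+ w) (hj : a j <:+ w) : i = j := by
  rcases List.suffix_or_suffix_of_suffix hi hj with h | h
  · exact hanti _ _ h.isInfix
  · exact (hanti _ _ h.isInfix).symm

open Classical in
/-- The real-valued indicator of a proposition. -/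
noncomputable def ind (P : Prop) : ℝ := if P then 1 else 0

theorem ind_true {P : Prop} (h : P) : ind P = 1 := if_pos h
theorem ind_false {P : Prop} (h : ¬ P) : ind P = 0 := if_neg h
theorem ind_nonneg (P : Prop) : 0 ≤ ind P := by
  unfold ind; split_ifs <;> norm_num
theorem ind_mono {P Q : Prop} (h : P → Q) : ind P ≤ ind Q := by
  by_cases hP : P
  · rw [ind_true hP, ind_true (h hP)]
  · rw [ind_false hP]; exact ind_nonneg _
theorem ind_congr {P Q : Prop} (h : P ↔ Q) : ind P = ind Q := by rw [propext h]

/-- A new letter either preserves avoidance or completes a forbidden word as a suffix, and only one,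
since no forbidden word contains another. -/
theorem ind_avoids_concat [Fintype ι] {a : ι → List (Fin q)}
    (hanti : ∀ i j, a i <:+: a j → i = j) (w : List (Fin q)) (c : Fin q) :
    ind (Avoids a w) = ind (Avoids a (w ++ [c])) + ∑ j, ind (FirstHit a j (w ++ [c])) := by
  by_cases hw : Avoids a w
  · rw [ind_true hw]
    by_cases hc : Avoids a (w ++ [c])
    · rw [ind_true hc, Finset.sum_eq_zero, add_zero]
      exact fun j _ => ind_false fun h => hc j h.1.isInfix
    · rw [ind_false hc, zero_add]
      obtain ⟨i, hi⟩ : ∃ i, a i <:+ w ++ [c] := by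
        by_contra! h
        refine hc fun i hi => ?_
        rcases List.infix_concat_iff.mp hi with h' | h'
        · exact h i h'
        · exact hw i h'
      rw [Finset.sum_eq_single i, ind_true]
      · exact ⟨hi, by simpa using hw⟩
      · exact fun j _ hj => ind_false fun h => hj (firstHit_unique hanti h.1 hi)
      · simp
  · rw [ind_false hw, ind_false, Finset.sum_eq_zero, add_zero]
    · exact fun j _ => ind_false fun h => hw (by simpa using h.2)
    · exact fun h => hw (h.of_infix List.infix_append_left)

/-- The one-letter identity telescopes along `x`; `k` records where in `x` the first forbidden word
ends. -/
theorem ind_avoids_append [Fintype ι] {a : ι → List (Fin q)}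
    (hanti : ∀ i j, a i <:+: a j → i = j) (v x : List (Fin q)) :
    ind (Avoids a v) = ind (Avoids a (v ++ x)) +
      ∑ k ∈ Finset.range x.length, ∑ j, ind (FirstHit a j (v ++ x.take (k + 1))) := by
  induction x using List.reverseRecOn with
  | nil => simp
  | append_singleton x c ih =>
    rw [List.length_append, List.length_singleton, Finset.sum_range_succ, ih,
      ind_avoids_concat hanti (v ++ x) c]
    have h1 : (x ++ [c]).take (x.length + 1) = x ++ [c] := by
      rw [List.take_of_length_le]; simp
    have h2 : ∀ k ∈ Finset.range x.length, (x ++ [c]).take (k + 1) = x.take (k + 1) := by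
      intro k hk
      rw [List.take_append_of_le_length]
      have := Finset.mem_range.mp hk
      omega
    have h3 : ∑ k ∈ Finset.range x.length, ∑ j, ind (FirstHit a j (v ++ (x ++ [c]).take (k + 1))) =
        ∑ k ∈ Finset.range x.length, ∑ j, ind (FirstHit a j (v ++ x.take (k + 1))) :=
      Finset.sum_congr rfl fun k hk => by rw [h2 k hk]
    rw [h1, h3, List.append_assoc]
    ring

/-- The overlap polynomial: the suffixes of `x` that are prefixes of `y`, a suffix of length
`k + 1` being weighted by `X ^ k`. -/
noncomputable def overlap (x y : List (Fin q)) : ℤ[X] :=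
  ∑ k ∈ Finset.range x.length, if x.drop (x.length - 1 - k) <+: y then X ^ k else 0

/-- The two sums differ only at shifts where `y` ends strictly inside `x`, which the hypothesis
excludes. -/
theorem corr_eq_overlap {x y : List (Fin q)} (h : ∀ l, y <+: x.drop l → x.drop l <+: y) :
    corr x y = overlap x y := by
  unfold corr overlap
  rw [← Finset.sum_range_reflect]
  refine Finset.sum_congr rfl fun k hk => ?_
  have := Finset.mem_range.mp hk
  have h1 : x.length - 1 - (x.length - 1 - k) = k := by omega
  rw [h1]
  refine if_congr ⟨fun h' => h'.elim id (h _), Or.inl⟩ rfl rfl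

theorem overlap_aux (x y : List (Fin q)) {k : ℕ} (hx : k < x.length) (hy : k < y.length) :
    x.drop (x.length - 1 - k) <+: y ↔ y.take (k + 1) <:+ x := by
  rw [List.prefix_iff_eq_take, List.suffix_iff_eq_drop]
  have h1 : (x.drop (x.length - 1 - k)).length = k + 1 := by simp; omega
  have h2 : x.length - (y.take (k + 1)).length = x.length - 1 - k := by simp; omega
  rw [h1, h2, eq_comm]

/-- Indexing by prefixes of `y` is the form in which overlaps arise when `y` is written letter by
letter. -/
theorem overlap_eq (x y : List (Fin q)) :
    overlap x y = ∑ k ∈ Finset.range y.length, if y.take (k + 1) <:+ x then X ^ k else 0 := by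
  have key : ∀ n m : ℕ, ∀ f g : ℕ → ℤ[X], (∀ k, m ≤ k → k < n → f k = 0) →
      (∀ k, n ≤ k → k < m → g k = 0) → (∀ k, k < n → k < m → f k = g k) →
      ∑ k ∈ Finset.range n, f k = ∑ k ∈ Finset.range m, g k := by
    intro n m f g hf hg hfg
    have e1 : ∑ k ∈ Finset.range n, f k = ∑ k ∈ Finset.range (min n m), f k := by
      refine (Finset.sum_subset (by simp) fun k hk hk' => hf k ?_ ?_).symm <;>
        simp at hk hk' <;> omega
    have e2 : ∑ k ∈ Finset.range m, g k = ∑ k ∈ Finset.range (min n m), g k := by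
      refine (Finset.sum_subset (by simp) fun k hk hk' => hg k ?_ ?_).symm <;>
        simp at hk hk' <;> omega
    rw [e1, e2]
    refine Finset.sum_congr rfl fun k hk => ?_
    simp at hk
    exact hfg k hk.1 hk.2
  refine key _ _ _ _ (fun k h1 h2 => if_neg fun h => ?_) (fun k h1 h2 => if_neg fun h => ?_)
    fun k h1 h2 => if_congr (overlap_aux x y h1 h2) rfl rfl
  · have := h.length_le
    simp at this
    omega
  · have := h.length_le
    simp at this
    omega

/-- Reversal swaps prefixes and suffixes; this later transfers results on rows of `𝓜` to columns. -/
theorem overlap_reverse (x y : List (Fin q)) :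
    overlap y.reverse x.reverse = overlap x y := by
  rw [overlap_eq x y, overlap, List.length_reverse]
  refine Finset.sum_congr rfl fun k hk => if_congr ?_ rfl rfl
  have := Finset.mem_range.mp hk
  rw [List.drop_reverse, List.reverse_prefix]
  have h1 : y.length - (y.length - 1 - k) = k + 1 := by omega
  rw [h1]

theorem overlap_congr_right {x y w : List (Fin q)} (h : ∀ l < x.length, x.drop l <+: y ↔ x.drop l <+: w) :
    overlap x y = overlap x w := by
  refine Finset.sum_congr rfl fun k hk => if_congr (h _ ?_) rfl rfl
  have := Finset.mem_range.mp hk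
  omega

theorem overlap_eq_corr_of_antichain {a : ι → List (Fin q)}
    (hanti : ∀ i j, a i <:+: a j → i = j) (i j : ι) :
    corr (a i) (a j) = overlap (a i) (a j) := by
  refine corr_eq_overlap fun l h => ?_
  have : j = i := hanti _ _ (h.isInfix.trans (List.drop_suffix _ _).isInfix)
  subst this
  have h1 := h.length_le
  rcases Nat.eq_zero_or_pos l with rfl | hl
  · simp
  · have h2 : (a j).length = 0 := by simp at h1; omega
    rw [List.length_eq_zero_iff.mp h2]
    simp

end

/-! ### Generating functions and the first-hit identity. -/

section

variable {q : ℕ} {ι : Type*}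

/-- The generating function in `z⁻¹` of the words `v` for which `v ++ x` is avoiding. -/
noncomputable def wordSeries (a : ι → List (Fin q)) (x : List (Fin q)) (z : ℝ) : ℝ :=
  ∑' v : List (Fin q), ind (Avoids a (v ++ x)) * z⁻¹ ^ v.length

/-- The generating function in `z⁻¹` of the words whose first forbidden subword is the
suffix `a j`. -/
noncomputable def hitSeries (a : ι → List (Fin q)) (j : ι) (z : ℝ) : ℝ :=
  ∑' v : List (Fin q), ind (FirstHit a j v) * z⁻¹ ^ v.length

/-- Convergence at `z` of the generating function of the avoiding words. -/
def SeriesConverges (a : ι → List (Fin q)) (z : ℝ) : Prop :=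
  Summable fun v : List (Fin q) => ind (Avoids a v) * z⁻¹ ^ v.length

section

variable {a : ι → List (Fin q)} {z : ℝ}

theorem SeriesConverges.summable (h : SeriesConverges a z) (hz : 0 < z)
    {P : List (Fin q) → Prop} (hP : ∀ v, P v → Avoids a v) :
    Summable fun v : List (Fin q) => ind (P v) * z⁻¹ ^ v.length :=
  Summable.of_nonneg_of_le (fun v => mul_nonneg (ind_nonneg _) (by positivity))
    (fun v => mul_le_mul_of_nonneg_right (ind_mono (hP v)) (by positivity)) h

theorem avoids_of_append {v x : List (Fin q)} (h : Avoids a (v ++ x)) : Avoids a v :=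
  h.of_infix List.infix_append_left

theorem FirstHit.avoids_of_append {j : ι} {v x : List (Fin q)} (hx : x ≠ [])
    (h : FirstHit a j (v ++ x)) : Avoids a v := by
  refine h.2.of_infix ?_
  rw [List.dropLast_append_of_ne_nil hx]
  exact List.infix_append_left

theorem wordSeries_nonneg (hz : 0 < z) (x : List (Fin q)) : 0 ≤ wordSeries a x z :=
  tsum_nonneg fun v => mul_nonneg (ind_nonneg _) (by positivity)

theorem hitSeries_nonneg (hz : 0 < z) (j : ι) : 0 ≤ hitSeries a j z :=
  tsum_nonneg fun v => mul_nonneg (ind_nonneg _) (by positivity)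

theorem wordSeries_nil_pos (h : SeriesConverges a z) (hz : 0 < z)
    (ha : ∀ i, a i ≠ []) : 0 < wordSeries a [] z := by
  have h1 : Avoids a [] := fun i hi => ha i (List.infix_nil.mp hi)
  have h2 : Summable fun v : List (Fin q) => ind (Avoids a (v ++ [])) * z⁻¹ ^ v.length := by
    simp only [List.append_nil]
    exact h
  refine h2.tsum_pos (fun v => mul_nonneg (ind_nonneg _) (by positivity)) [] ?_
  simp [ind_true h1]

theorem wordSeries_eq_zero {x : List (Fin q)} (hx : ¬ Avoids a x) : wordSeries a x z = 0 := by
  have : ∀ v : List (Fin q), ind (Avoids a (v ++ x)) * z⁻¹ ^ v.length = 0 := fun v => by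
    rw [ind_false fun h => hx (h.of_infix List.infix_append_right), zero_mul]
  simp only [wordSeries, this, tsum_zero]

/-- Every word ending in `a j` ends in `d`, so `v ↦ v ++ d` reaches all first hits; stripping `d`
changes the weight by `z ^ d.length`. -/
theorem tsum_firstHit_append (hz : 0 < z) {j : ι} {d : List (Fin q)} (hd : d <:+ a j) :
    ∑' v : List (Fin q), ind (FirstHit a j (v ++ d)) * z⁻¹ ^ v.length =
      z ^ d.length * hitSeries a j z := by
  have hinj : Function.Injective fun v : List (Fin q) => v ++ d := List.append_left_injective d
  have h := hinj.tsum_eq (f := fun w => ind (FirstHit a j w) * z⁻¹ ^ w.length) (by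
    intro w hw
    have hw' : FirstHit a j w := by
      by_contra hcon
      exact hw (by simp [ind_false hcon])
    obtain ⟨s, hs⟩ := hd.trans hw'.1
    exact ⟨s, hs⟩)
  rw [hitSeries, ← h, ← tsum_mul_left]
  refine tsum_congr fun v => ?_
  simp only [List.length_append, pow_add]
  have : z ^ d.length * z⁻¹ ^ d.length = 1 := by rw [← mul_pow, mul_inv_cancel₀ hz.ne', one_pow]
  linear_combination (-ind (FirstHit a j (v ++ d)) * z⁻¹ ^ v.length) * this

/-- If `x.take (k + 1)` is not a suffix of `a j`, then a hit `a j` ending there is a strictly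
shorter suffix of it, hence lies in `x.tail`. -/
theorem not_firstHit_append_take {x : List (Fin q)} (hx : ∀ i, ¬ a i <:+: x.tail) {j : ι} {k : ℕ}
    (hd : ¬ x.take (k + 1) <:+ a j) (v : List (Fin q)) :
    ¬ FirstHit a j (v ++ x.take (k + 1)) := by
  intro h
  rcases List.suffix_or_suffix_of_suffix h.1 (List.suffix_append v (x.take (k + 1))) with h' | h'
  · cases x with
    | nil => exact hd (by simp)
    | cons c x =>
      rw [List.take_succ_cons] at h' hd
      rcases List.suffix_cons_iff.mp h' with h'' | h''
      · exact hd (h'' ▸ List.suffix_rfl)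
      · exact hx j (h''.isInfix.trans (List.take_prefix _ _).isInfix)
  · exact hd h'

/-- Deleting the last letter of a first hit leaves an avoiding word and gains a factor `z`. This
bounds the row sums by `1`. -/
theorem mul_hitSeries_le (h : SeriesConverges a z) (hz : 0 < z) {j : ι} (hj : a j ≠ []) :
    z * hitSeries a j z ≤ wordSeries a [] z := by
  have hd : [(a j).getLast hj] <:+ a j :=
    ⟨(a j).dropLast, List.dropLast_append_getLast hj⟩
  have h1 := tsum_firstHit_append hz hd
  rw [List.length_singleton, pow_one] at h1
  rw [← h1, wordSeries]
  simp only [List.append_nil]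
  have hP : ∀ v, FirstHit a j (v ++ [(a j).getLast hj]) → Avoids a v := fun v =>
    FirstHit.avoids_of_append (by simp)
  exact (h.summable hz hP).tsum_le_tsum
    (fun v => mul_le_mul_of_nonneg_right (ind_mono (hP v)) (by positivity)) h

variable [Fintype ι]

open Classical in
-- Sum `ind_avoids_append` over `v`: a hit by `a j` after `k + 1` letters of `x` contributes exactly
-- when those letters form a suffix of `a j`. Restricting only `x.tail` keeps the case `x = a i`
-- available.
theorem wordSeries_nil_eq (hanti : ∀ i j, a i <:+: a j → i = j) (h : SeriesConverges a z)
    (hz : 0 < z) {x : List (Fin q)} (hx : ∀ i, ¬ a i <:+: x.tail) :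
    wordSeries a [] z = wordSeries a x z +
      ∑ j, z * aeval z (overlap (a j) x) * hitSeries a j z := by
  have hterm : ∀ k ∈ Finset.range x.length, ∀ j,
      ∑' v : List (Fin q), ind (FirstHit a j (v ++ x.take (k + 1))) * z⁻¹ ^ v.length =
        if x.take (k + 1) <:+ a j then z ^ (k + 1) * hitSeries a j z else 0 := by
    intro k hk j
    have := Finset.mem_range.mp hk
    split_ifs with hd
    · rw [tsum_firstHit_append hz hd, List.length_take, min_eq_left (by omega)]
    · simp [ind_false (not_firstHit_append_take hx hd _)]
  have hs1 : Summable fun v : List (Fin q) => ind (Avoids a (v ++ x)) * z⁻¹ ^ v.length :=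
    h.summable hz fun v => avoids_of_append
  have hs2 : ∀ k ∈ Finset.range x.length, ∀ j, Summable fun v : List (Fin q) =>
      ind (FirstHit a j (v ++ x.take (k + 1))) * z⁻¹ ^ v.length := fun k hk j =>
    h.summable hz fun v => FirstHit.avoids_of_append (by
      have := Finset.mem_range.mp hk
      intro h0
      have := congrArg List.length h0
      simp at this
      simp [this] at hk)
  have hsplit : wordSeries a [] z = wordSeries a x z + ∑ k ∈ Finset.range x.length, ∑ j,
      ∑' v : List (Fin q), ind (FirstHit a j (v ++ x.take (k + 1))) * z⁻¹ ^ v.length := by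
    have e1 : ∀ k ∈ Finset.range x.length, ∑ j,
        ∑' v : List (Fin q), ind (FirstHit a j (v ++ x.take (k + 1))) * z⁻¹ ^ v.length =
        ∑' v : List (Fin q), ∑ j, ind (FirstHit a j (v ++ x.take (k + 1))) * z⁻¹ ^ v.length :=
      fun k hk => (Summable.tsum_finsetSum fun j _ => hs2 k hk j).symm
    rw [Finset.sum_congr rfl e1,
      ← Summable.tsum_finsetSum fun k hk => summable_sum fun j _ => hs2 k hk j, wordSeries,
      wordSeries, ← Summable.tsum_add hs1 (summable_sum fun k hk =>
        summable_sum fun j _ => hs2 k hk j)]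
    refine tsum_congr fun v => ?_
    rw [List.append_nil, ind_avoids_append hanti v x, add_mul, Finset.sum_mul]
    simp_rw [Finset.sum_mul]
  rw [hsplit, Finset.sum_congr rfl fun k hk => Finset.sum_congr rfl fun j _ => hterm k hk j,
    Finset.sum_comm]
  congr 1
  refine Finset.sum_congr rfl fun j _ => ?_
  rw [overlap_eq, map_sum, Finset.mul_sum, Finset.sum_mul]
  refine Finset.sum_congr rfl fun k _ => ?_
  split_ifs
  · rw [map_pow, aeval_X]; ring
  · simp

end

end

/-! ### Joining words, and limits of rational functions. -/

section

variable {q : ℕ} {ι : Type*}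

/-- Send an avoiding `v` to `v ++ e` with a suitable `e ∈ E`; for fixed `e` this is injective and
costs the factor `z ^ e.length`. -/
theorem wordSeries_nil_le {a : ι → List (Fin q)} {z : ℝ} (h : SeriesConverges a z) (hz : 0 < z)
    {x : List (Fin q)} (E : Finset (List (Fin q)))
    (hE : ∀ v, Avoids a v → ∃ e ∈ E, Avoids a (v ++ (e ++ x))) :
    wordSeries a [] z ≤ (∑ e ∈ E, z ^ e.length) * wordSeries a x z := by
  have hs : ∀ e : List (Fin q), Summable fun v : List (Fin q) =>
      ind (Avoids a (v ++ (e ++ x))) * z⁻¹ ^ v.length := fun e =>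
    h.summable hz fun v => avoids_of_append
  have hx : Summable fun v : List (Fin q) => ind (Avoids a (v ++ x)) * z⁻¹ ^ v.length :=
    h.summable hz fun v => avoids_of_append
  have h1 : ∀ e : List (Fin q),
      ∑' v : List (Fin q), ind (Avoids a (v ++ (e ++ x))) * z⁻¹ ^ v.length ≤
        z ^ e.length * wordSeries a x z := by
    intro e
    have hinj : Function.Injective fun v : List (Fin q) => v ++ e := List.append_left_injective e
    rw [wordSeries, ← tsum_mul_left]
    refine (hs e).tsum_le_tsum_of_inj _ hinj (fun c _ => ?_) (fun v => ?_) (hx.mul_left _)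
    · have := ind_nonneg (Avoids a (c ++ x))
      positivity
    · simp only [List.length_append, pow_add, List.append_assoc]
      have : z ^ e.length * z⁻¹ ^ e.length = 1 := by
        rw [← mul_pow, mul_inv_cancel₀ hz.ne', one_pow]
      refine le_of_eq ?_
      linear_combination (-ind (Avoids a (v ++ (e ++ x))) * z⁻¹ ^ v.length) * this
  calc wordSeries a [] z
      ≤ ∑' v : List (Fin q), ∑ e ∈ E, ind (Avoids a (v ++ (e ++ x))) * z⁻¹ ^ v.length := by
        rw [wordSeries]
        simp only [List.append_nil]
        refine Summable.tsum_le_tsum (fun v => ?_) h (summable_sum fun e _ => hs e)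
        rw [← Finset.sum_mul]
        refine mul_le_mul_of_nonneg_right ?_ (by positivity)
        by_cases hv : Avoids a v
        · obtain ⟨e, he, hev⟩ := hE v hv
          rw [ind_true hv, ← ind_true hev]
          exact Finset.single_le_sum (f := fun e => ind (Avoids a (v ++ (e ++ x))))
            (fun e _ => ind_nonneg _) he
        · rw [ind_false hv]
          exact Finset.sum_nonneg fun e _ => ind_nonneg _
    _ = ∑ e ∈ E, ∑' v : List (Fin q), ind (Avoids a (v ++ (e ++ x))) * z⁻¹ ^ v.length :=
        Summable.tsum_finsetSum fun e _ => hs e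
    _ ≤ ∑ e ∈ E, z ^ e.length * wordSeries a x z := Finset.sum_le_sum fun e _ => h1 e
    _ = _ := by rw [Finset.sum_mul]

/-- Any two avoiding words can be joined by a word in between. -/
def Joinable (a : ι → List (Fin q)) : Prop :=
  ∀ u v, Avoids a u → Avoids a v → ∃ e, Avoids a (u ++ (e ++ v))

/-- By gluing, a connecting word chosen for the last `m` letters of `v` also works for `v`, and
there are finitely many such endings. -/
theorem Joinable.exists_finset {a : ι → List (Fin q)} (hj : Joinable a) {m : ℕ}
    (hlen : ∀ i, (a i).length ≤ m + 1) {x : List (Fin q)} (hx : Avoids a x) :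
    ∃ E : Finset (List (Fin q)), ∀ v, Avoids a v → ∃ e ∈ E, Avoids a (v ++ (e ++ x)) := by
  classical
  have hfin : {y : List (Fin q) | y.length ≤ m}.Finite := List.finite_length_le _ _
  have : ∀ y : List (Fin q), ∃ e, Avoids a y → Avoids a (y ++ (e ++ x)) := fun y => by
    by_cases hy : Avoids a y
    · obtain ⟨e, he⟩ := hj y x hy hx
      exact ⟨e, fun _ => he⟩
    · exact ⟨[], fun h => absurd h hy⟩
  choose e he using this
  refine ⟨hfin.toFinset.image e, fun v hv => ?_⟩
  set y := v.drop (v.length - m) with hy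
  have hyv : v.take (v.length - m) ++ y = v := List.take_append_drop _ _
  have hyl : y.length ≤ m := by rw [hy, List.length_drop]; omega
  refine ⟨e y, Finset.mem_image_of_mem _ (by simpa using hyl), ?_⟩
  have h1 : Avoids a (y ++ (e y ++ x)) := he y (hv.of_infix (List.drop_suffix _ _).isInfix)
  by_cases hvm : v.length ≤ m
  · have : y = v := by rw [hy]; simp [Nat.sub_eq_zero_of_le hvm]
    rw [this] at h1 ⊢
    exact h1
  · rw [← hyv]
    rw [← hyv] at hv
    have h2 := Avoids.glue hlen hv h1 (by rw [hy, List.length_drop]; omega)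
    simp only [hyv] at h2 ⊢
    exact h2

/-- A function meromorphic at a real point whose values at real points to the right are bounded
has a limit there, and the limit is real if these values are. -/
theorem exists_tendsto_of_meromorphicAt {f : ℂ → ℂ} {g : ℝ → ℝ} {θ : ℝ} (hf : MeromorphicAt f θ)
    (hfg : ∀ z : ℝ, f z = g z) {C : ℝ} (hb : ∀ᶠ z in 𝓝[>] θ, |g z| ≤ C) :
    ∃ c : ℝ, Tendsto f (𝓝[≠] (θ : ℂ)) (𝓝 (c : ℂ)) ∧ Tendsto g (𝓝[≠] θ) (𝓝 c) := by
  have hr : Tendsto (fun z : ℝ => (z : ℂ)) (𝓝[≠] θ) (𝓝[≠] (θ : ℂ)) := by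
    refine tendsto_nhdsWithin_iff.mpr ⟨?_, ?_⟩
    · exact (Complex.continuous_ofReal.tendsto θ).mono_left nhdsWithin_le_nhds
    · filter_upwards [self_mem_nhdsWithin] with z hz
      simpa using hz
  have hgt : 𝓝[>] θ ≤ 𝓝[≠] θ := nhdsWithin_mono _ fun z hz => ne_of_gt hz
  obtain ⟨c, hc⟩ : ∃ c, Tendsto f (𝓝[≠] (θ : ℂ)) (𝓝 c) := by
    rw [tendsto_nhds_iff_meromorphicOrderAt_nonneg hf]
    -- Otherwise there is a pole, and the norm tends to infinity also along the reals from the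
    -- right, against the bound.
    by_contra! hneg
    have h1 := (tendsto_cobounded_iff_meromorphicOrderAt_neg hf).mpr hneg
    have h2 := tendsto_norm_cobounded_atTop.comp (h1.comp (hr.mono_left hgt))
    obtain ⟨z, hz1, hz2⟩ := (hb.and (h2.eventually_gt_atTop C)).exists
    simp [hfg] at hz2
    linarith
  have h3 : Tendsto (fun z : ℝ => ((g z : ℝ) : ℂ)) (𝓝[≠] θ) (𝓝 c) :=
    (hc.comp hr).congr fun z => hfg z
  have h4 : Tendsto g (𝓝[≠] θ) (𝓝 c.re) :=
    ((Complex.continuous_re.tendsto c).comp h3).congr fun z => by simp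
  have h5 : c = (c.re : ℂ) :=
    tendsto_nhds_unique h3 ((Complex.continuous_ofReal.tendsto _).comp h4)
  exact ⟨c.re, h5 ▸ hc, h4⟩

theorem eventually_aeval_ne_zero {K : Type*} [Field K] [CharZero K] [TopologicalSpace K] [T1Space K]
    {f : ℤ[X]} (hf : f ≠ 0) (θ : K) : ∀ᶠ z in 𝓝[≠] θ, aeval z f ≠ 0 := by
  have h : f.map (algebraMap ℤ K) ≠ 0 := by
    rwa [Ne, Polynomial.map_eq_zero_iff (algebraMap ℤ K).injective_int]
  -- Only roots other than `θ` are removed: `f` may vanish at `θ` itself.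
  have hfin : ((f.map (algebraMap ℤ K)).rootSet K).Finite := Polynomial.rootSet_finite _ _
  have := (hfin.subset (Set.sep_subset _ (fun z => z ≠ θ))).isClosed.isOpen_compl.mem_nhds
    (x := θ) (by simp)
  filter_upwards [nhdsWithin_le_nhds this, self_mem_nhdsWithin] with z h1 h2 h3
  refine h1 ⟨?_, h2⟩
  rw [Polynomial.mem_rootSet]
  refine ⟨h, ?_⟩
  rw [aeval_map_algebraMap, h3]

section

variable [Fintype ι] [DecidableEq ι]

/-- Exhibits the row sum as a quotient of integer polynomials; at zeros of the determinant both
sides are `0` by convention. -/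
theorem rowSum_eq {K : Type*} [Field K] (a : ι → List (Fin q)) (i : ι) (z : K) :
    rowSum a i z = (aeval z (corrDet a))⁻¹ * aeval z (∑ j, (corrMatrix a).adjugate i j) := by
  have h1 : ((corrMatrix a).map fun f => aeval z f) =
      ((aeval z : ℤ[X] →ₐ[ℤ] K) : ℤ[X] →+* K).mapMatrix (corrMatrix a) := rfl
  rw [rowSum, h1, Matrix.inv_def, ← RingHom.map_det, ← RingHom.map_adjugate, Ring.inverse_eq_inv,
    map_sum, Finset.mul_sum]
  rfl

theorem meromorphicAt_rowSum (a : ι → List (Fin q)) (i : ι) (z : ℂ) :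
    MeromorphicAt (fun z : ℂ => rowSum a i z) z := by
  have h : ∀ f : ℤ[X], MeromorphicAt (fun z : ℂ => aeval z f) z := fun f =>
    ((analyticAt_id (𝕜 := ℂ) (z := z)).aeval_polynomial f).meromorphicAt
  simp only [rowSum_eq]
  exact (h _).inv.mul (h _)

theorem rowSum_ofReal (a : ι → List (Fin q)) (i : ι) (z : ℝ) :
    rowSum a i (z : ℂ) = ((rowSum a i z : ℝ) : ℂ) := by
  have h : ∀ f : ℤ[X], aeval (z : ℂ) f = ((aeval z f : ℝ) : ℂ) := fun f =>
    aeval_algebraMap_apply ℂ z f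
  rw [rowSum_eq, rowSum_eq, h, h]
  push_cast
  rfl

end

end

/-! ### Nonvanishing of `𝓓` and the limits of the row sums. -/

section

variable {q : ℕ} {ι : Type*} [Fintype ι] [DecidableEq ι]

theorem overlap_bounds_of_not_prefix {x y : List (Fin q)} (hxy : ¬ x <+: y) {z : ℝ} (hz : 0 ≤ z) :
    0 ≤ aeval z (overlap x y) ∧
      aeval z (overlap x y) ≤ ∑ k ∈ Finset.range (x.length - 1), z ^ k := by
  constructor
  · rw [overlap, map_sum]
    refine Finset.sum_nonneg fun k _ => ?_
    split_ifs
    · rw [map_pow, aeval_X]; positivity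
    · simp
  · rcases Nat.eq_zero_or_pos x.length with h | h
    · exact absurd (by rw [List.length_eq_zero_iff.mp h]; exact List.nil_prefix) hxy
    · obtain ⟨n, hn⟩ : ∃ n, x.length = n + 1 := ⟨x.length - 1, by omega⟩
      rw [overlap, hn, Finset.sum_range_succ, map_add, map_sum]
      simp only [Nat.add_sub_cancel, Nat.sub_self, List.drop_zero, if_neg hxy, map_zero, add_zero]
      refine Finset.sum_le_sum fun k _ => ?_
      split_ifs
      · rw [map_pow, aeval_X]
      · simp only [map_zero]; positivity

theorem pow_le_overlap_self {x : List (Fin q)} (hx : x ≠ []) {z : ℝ} (hz : 0 ≤ z) :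
    z ^ (x.length - 1) ≤ aeval z (overlap x x) := by
  have h := List.length_pos_iff.mpr hx
  rw [overlap, map_sum]
  refine le_trans ?_ (Finset.single_le_sum
    (f := fun k => aeval z (if x.drop (x.length - 1 - k) <+: x then (X ^ k : ℤ[X]) else 0))
    (fun k _ => ?_) (Finset.mem_range.mpr (show x.length - 1 < x.length by omega)))
  · simp
  · split_ifs
    · rw [map_pow, aeval_X]; positivity
    · simp

/-- At `z = card ι + 1` the matrix is strictly column dominant: with `n + 1` the length of `a j`,
the off-diagonal entries of column `j` are at most `(z ^ n - 1) / (z - 1)` each, so together at most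
`z ^ n - 1`, while the diagonal entry is at least `z ^ n`. -/
theorem corrDet_ne_zero {a : ι → List (Fin q)} (hanti : ∀ i j, a i <:+: a j → i = j)
    (hne : ∀ i, a i ≠ []) : corrDet a ≠ 0 := by
  intro h0
  set z : ℝ := Fintype.card ι + 1 with hz
  have hz0 : 0 ≤ z := by positivity
  have h1 : (((aeval z : ℤ[X] →ₐ[ℤ] ℝ) : ℤ[X] →+* ℝ).mapMatrix (corrMatrix a)).det = 0 := by
    rw [← RingHom.map_det, show (corrMatrix a).det = 0 from h0, map_zero]
  refine det_ne_zero_of_sum_col_lt_diag (fun j => ?_) h1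
  have hentry : ∀ i, ((aeval z : ℤ[X] →ₐ[ℤ] ℝ) : ℤ[X] →+* ℝ).mapMatrix (corrMatrix a) i j =
      aeval z (overlap (a j) (a i)) := fun i => by
    rw [← overlap_eq_corr_of_antichain hanti]; rfl
  simp only [hentry, Real.norm_eq_abs]
  set n := (a j).length - 1
  set S := ∑ k ∈ Finset.range n, z ^ k with hS
  have hgeom : S * (Fintype.card ι : ℝ) = z ^ n - 1 := by
    have := geom_sum_mul z n
    rwa [hz, add_sub_cancel_right, ← hz] at this
  have hS0 : 0 ≤ S := Finset.sum_nonneg fun k _ => by positivity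
  calc ∑ i ∈ Finset.univ.erase j, |aeval z (overlap (a j) (a i))|
      ≤ ∑ i ∈ Finset.univ.erase j, S := by
        refine Finset.sum_le_sum fun i hi => ?_
        have hij : ¬ a j <+: a i := fun h =>
          (Finset.mem_erase.mp hi).1 (hanti _ _ h.isInfix).symm
        obtain ⟨h2, h3⟩ := overlap_bounds_of_not_prefix hij hz0
        rwa [abs_of_nonneg h2]
    _ ≤ ∑ i : ι, S := Finset.sum_le_sum_of_subset_of_nonneg (Finset.erase_subset _ _)
        fun _ _ _ => hS0
    _ = S * (Fintype.card ι : ℝ) := by simp [mul_comm]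
    _ < z ^ n := by rw [hgeom]; linarith
    _ ≤ _ := (pow_le_overlap_self (hne j) hz0).trans (le_abs_self _)

theorem map_aeval_det {K : Type*} [Field K] (a : ι → List (Fin q)) (z : K) :
    ((corrMatrix a).map fun f => aeval z f).det = aeval z (corrDet a) := by
  have h1 : ((corrMatrix a).map fun f => aeval z f) =
      ((aeval z : ℤ[X] →ₐ[ℤ] K) : ℤ[X] →+* K).mapMatrix (corrMatrix a) := rfl
  rw [h1, ← RingHom.map_det]
  rfl

/-- Taking `x = a i` in `wordSeries_nil_eq` for every `i` gives a linear system with matrix `𝓜(z)`,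
which is then inverted. -/
theorem rowSum_mul_wordSeries {a : ι → List (Fin q)} (hanti : ∀ i j, a i <:+: a j → i = j)
    (hne : ∀ i, a i ≠ []) {z : ℝ} (h : SeriesConverges a z) (hz : 0 < z) (hdet : aeval z (corrDet a) ≠ 0) (i : ι) :
    rowSum a i z * wordSeries a [] z = z * hitSeries a i z := by
  set N := (corrMatrix a).map fun f => aeval z f with hN
  have hunit : IsUnit N.det := by
    rw [hN, map_aeval_det]; exact hdet.isUnit
  have h1 : N.mulVec (fun j => z * hitSeries a j z) = fun _ => wordSeries a [] z := by
    ext i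
    have hx : ∀ j, ¬ a j <:+: (a i).tail := fun j hj => by
      have hji := hanti _ _ (hj.trans (List.tail_suffix _).isInfix)
      subst hji
      have h2 := hj.length_le
      rw [List.length_tail] at h2
      have h3 : (a j).length = 0 := by
        omega
      exact hne j (List.length_eq_zero_iff.mp h3)
    rw [wordSeries_nil_eq hanti h hz hx, wordSeries_eq_zero (fun h => h i List.infix_rfl), zero_add]
    refine Finset.sum_congr rfl fun j _ => ?_
    have hentry : N i j = aeval z (overlap (a j) (a i)) := by
      rw [← overlap_eq_corr_of_antichain hanti]; rfl
    change N i j * (z * hitSeries a j z) = _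
    rw [hentry]
    ring
  have h2 := congrArg (fun v => (N⁻¹.mulVec v) i) h1
  simp only [Matrix.mulVec_mulVec, Matrix.nonsing_inv_mul _ hunit, Matrix.one_mulVec] at h2
  rw [h2, rowSum, Finset.sum_mul]
  rfl

/-- The limits of the row sums exist, and the associated vector is positive. -/
theorem exists_rowSum_limit {a : ι → List (Fin q)} {m : ℕ} (hanti : ∀ i j, a i <:+: a j → i = j)
    (hne : ∀ i, a i ≠ []) (hlen : ∀ i, (a i).length ≤ m + 1) (hj : Joinable a)
    {θ : ℝ} (hθ : 0 ≤ θ) (hs : ∀ z, θ < z → SeriesConverges a z) :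
    ∃ R : ι → ℝ, (∀ i, Tendsto (fun z : ℂ => rowSum a i z) (𝓝[≠] (θ : ℂ)) (𝓝 (R i : ℂ))) ∧
      (∀ i, Tendsto (fun z : ℝ => rowSum a i z) (𝓝[≠] θ) (𝓝 (R i))) ∧
      ∀ x, Avoids a x → 0 < 1 - ∑ i, R i * aeval θ (overlap (a i) x) := by
  have hgt : 𝓝[>] θ ≤ 𝓝[≠] θ := nhdsWithin_mono _ fun z hz => ne_of_gt hz
  have hdet : ∀ᶠ z : ℝ in 𝓝[>] θ, aeval z (corrDet a) ≠ 0 :=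
    hgt (eventually_aeval_ne_zero (corrDet_ne_zero hanti hne) θ)
  have hF : ∀ z, θ < z → 0 < wordSeries a [] z := fun z hz =>
    wordSeries_nil_pos (hs z hz) (hθ.trans_lt hz) hne
  have hlim : ∀ i, ∃ c : ℝ, Tendsto (fun z : ℂ => rowSum a i z) (𝓝[≠] (θ : ℂ)) (𝓝 (c : ℂ)) ∧
      Tendsto (fun z : ℝ => rowSum a i z) (𝓝[≠] θ) (𝓝 c) := by
    intro i
    refine exists_tendsto_of_meromorphicAt (meromorphicAt_rowSum a i θ) (rowSum_ofReal a i)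
      (C := 1) ?_
    filter_upwards [hdet, self_mem_nhdsWithin] with z hz1 hz2
    have hz0 : 0 < z := hθ.trans_lt hz2
    have h1 := rowSum_mul_wordSeries hanti hne (hs z hz2) hz0 hz1 i
    have h2 := mul_hitSeries_le (hs z hz2) hz0 (hne i)
    have h3 := mul_nonneg hz0.le (hitSeries_nonneg (a := a) hz0 i)
    rw [← h1] at h2 h3
    have h4 := hF z hz2
    rw [abs_le]
    constructor
    · have := nonneg_of_mul_nonneg_left h3 h4
      linarith
    · by_contra! hcon
      nlinarith
  choose R hR1 hR2 using hlim
  refine ⟨R, hR1, hR2, fun x hx => ?_⟩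
  obtain ⟨E, hE⟩ := hj.exists_finset hlen hx
  -- Bounds the joining cost for all `z` in `(θ, θ + 1]`; the extra `1` makes positivity immediate.
  set C : ℝ := ∑ e ∈ E, (θ + 1) ^ e.length + 1 with hC
  have hC0 : 0 < C := by positivity
  have hpoly : ∀ f : ℤ[X], Tendsto (fun z : ℝ => aeval z f) (𝓝[>] θ) (𝓝 (aeval θ f)) := fun f =>
    (f.continuous_aeval.tendsto θ).mono_left nhdsWithin_le_nhds
  have htend : Tendsto (fun z : ℝ => 1 - ∑ i, rowSum a i z * aeval z (overlap (a i) x)) (𝓝[>] θ)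
      (𝓝 (1 - ∑ i, R i * aeval θ (overlap (a i) x))) :=
    tendsto_const_nhds.sub (tendsto_finsetSum _ fun i _ => ((hR2 i).mono_left hgt).mul (hpoly _))
  -- The expression equals `F_x / F`. A uniform lower bound is needed, since positivity alone need
  -- not survive the limit.
  have hlow : ∀ᶠ z : ℝ in 𝓝[>] θ, 1 / C ≤ 1 - ∑ i, rowSum a i z * aeval z (overlap (a i) x) := by
    filter_upwards [hdet, Ioc_mem_nhdsGT (show θ < θ + 1 by linarith)] with z hz1 hz2
    have hz0 : 0 < z := hθ.trans_lt hz2.1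
    have hFz := hF z hz2.1
    have h1 : (1 - ∑ i, rowSum a i z * aeval z (overlap (a i) x)) * wordSeries a [] z =
        wordSeries a x z := by
      have h2 := wordSeries_nil_eq hanti (hs z hz2.1) hz0 (x := x)
        fun i hi => hx i (hi.trans (List.tail_suffix _).isInfix)
      rw [sub_mul, one_mul, Finset.sum_mul, sub_eq_iff_eq_add]
      refine h2.trans ?_
      congr 1
      refine Finset.sum_congr rfl fun i _ => ?_
      linear_combination
        (-aeval z (overlap (a i) x)) * rowSum_mul_wordSeries hanti hne (hs z hz2.1) hz0 hz1 i
    have h3 := wordSeries_nil_le (hs z hz2.1) hz0 E hE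
    have h4 : ∑ e ∈ E, z ^ e.length ≤ C := by
      have : ∑ e ∈ E, z ^ e.length ≤ ∑ e ∈ E, (θ + 1) ^ e.length :=
        Finset.sum_le_sum fun e _ => pow_le_pow_left₀ hz0.le hz2.2 _
      linarith
    have h5 : wordSeries a [] z ≤ C * wordSeries a x z :=
      h3.trans (mul_le_mul_of_nonneg_right h4 (wordSeries_nonneg hz0 x))
    rw [← h1] at h5
    rw [div_le_iff₀ hC0]
    by_contra! hcon
    nlinarith
  exact lt_of_lt_of_le (by positivity) (ge_of_tendsto htend hlow)

end

/-! ### Reversal of words, and the bordered correlation matrix. -/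

section

variable {q : ℕ} {ι : Type*}

section

variable {a : ι → List (Fin q)}

theorem antichain_reverse (hanti : ∀ i j, a i <:+: a j → i = j) (i j : ι)
    (h : (a i).reverse <:+: (a j).reverse) : i = j :=
  hanti i j (List.reverse_infix.mp h)

theorem avoids_reverse {w : List (Fin q)} :
    Avoids (fun i => (a i).reverse) w ↔ Avoids a w.reverse :=
  forall_congr' fun i => not_congr (by rw [← List.reverse_infix, List.reverse_reverse])

theorem Joinable.reverse (h : Joinable a) : Joinable fun i => (a i).reverse := by
  intro u v hu hv
  obtain ⟨e, he⟩ := h _ _ (avoids_reverse.mp hv) (avoids_reverse.mp hu)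
  exact ⟨e.reverse, avoids_reverse.mpr (by simpa using he)⟩

theorem SeriesConverges.reverse {z : ℝ} (h : SeriesConverges a z) :
    SeriesConverges (fun i => (a i).reverse) z := by
  have h1 := (List.reverse_involutive (α := Fin q)).toPerm.summable_iff.mpr h
  refine h1.congr fun v => ?_
  simp only [Function.comp_apply, Function.Involutive.coe_toPerm, List.length_reverse]
  rw [ind_congr avoids_reverse]

theorem corrMatrix_reverse (hanti : ∀ i j, a i <:+: a j → i = j) :
    corrMatrix (fun i => (a i).reverse) = (corrMatrix a).transpose := by
  ext1 i j
  change corr (a j).reverse (a i).reverse = corr (a i) (a j)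
  rw [overlap_eq_corr_of_antichain hanti, ← overlap_reverse]
  exact overlap_eq_corr_of_antichain (antichain_reverse hanti) j i

theorem rowSum_reverse [Fintype ι] [DecidableEq ι] (hanti : ∀ i j, a i <:+: a j → i = j)
    {K : Type*} [Field K] (j : ι) (z : K) :
    rowSum (fun i => (a i).reverse) j z = colSum a j z := by
  rw [rowSum, colSum, corrMatrix_reverse hanti, Matrix.transpose_map, ← Matrix.transpose_nonsing_inv]
  rfl

end

section

open Matrix

theorem corrMatrix_adjoin {K : Type*} [Field K] (a : ι → List (Fin q)) (w : List (Fin q)) (z : K) :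
    ((corrMatrix (adjoin a w)).map fun f => aeval z f) =
      fromBlocks ((corrMatrix a).map fun f => aeval z f)
        (replicateCol Unit fun i => aeval z (corr w (a i)))
        (replicateRow Unit fun j => aeval z (corr (a j) w)) (of fun _ _ => aeval z (corr w w)) := by
  ext i j
  rcases i with i | i <;> rcases j with j | j <;> rfl

variable {K : Type*} [Field K] [Fintype ι] [DecidableEq ι]

theorem sum_adjugate_eq (M : Matrix ι ι K) (hM : M.det ≠ 0) :
    ∑ i, ∑ j, M.adjugate i j = M.det * ∑ i, ∑ j, M⁻¹ i j := by
  rw [Finset.mul_sum]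
  refine Finset.sum_congr rfl fun i _ => ?_
  rw [Finset.mul_sum]
  refine Finset.sum_congr rfl fun j _ => ?_
  rw [Matrix.inv_def, Ring.inverse_eq_inv, Matrix.smul_apply, smul_eq_mul,
    mul_inv_cancel_left₀ hM]

/-- Solving `N k = 1` by blocks gives the last coordinate `k₂` as `1 - r ⬝ᵥ ρ` over the Schur
complement `d - r ⬝ᵥ κ`. The entry sums of `N⁻¹` and `M⁻¹` differ by `k₂ (1 - ∑ i, κ i)`, and the
factor `det N` cancels the denominator. -/
theorem bordered_adjugate_sum (M : Matrix ι ι K) (c r : ι → K) (d : K) (hM : M.det ≠ 0)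
    (hN : (fromBlocks M (replicateCol Unit c) (replicateRow Unit r) (of fun _ _ => d)).det ≠ 0) :
    M.det * (∑ i, ∑ j,
        (fromBlocks M (replicateCol Unit c) (replicateRow Unit r) (of fun _ _ => d)).adjugate i j) -
      (∑ i, ∑ j, M.adjugate i j) *
        (fromBlocks M (replicateCol Unit c) (replicateRow Unit r) (of fun _ _ => d)).det =
      M.det ^ 2 * ((1 - ∑ j, (∑ i, M⁻¹ j i) * r j) * (1 - ∑ i, (∑ j, M⁻¹ j i) * c i)) := by
  set N := fromBlocks M (replicateCol Unit c) (replicateRow Unit r) (of fun _ _ => d) with hNdef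
  have hMu : IsUnit M.det := hM.isUnit
  have hNu : IsUnit N.det := hN.isUnit
  set k : ι ⊕ Unit → K := N⁻¹ *ᵥ fun _ => 1 with hk
  have hNk : N *ᵥ k = fun _ => 1 := by
    rw [hk, mulVec_mulVec, mul_nonsing_inv _ hNu, one_mulVec]
  set k₁ : ι → K := fun i => k (Sum.inl i) with hk₁
  set k₂ : K := k (Sum.inr ()) with hk₂
  set ρ : ι → K := fun i => ∑ j, M⁻¹ i j with hρ
  set κ : ι → K := M⁻¹ *ᵥ c with hκ
  have hdet : N.det = M.det * (d - r ⬝ᵥ κ) := by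
    let _ : Invertible M := M.invertibleOfIsUnitDet hMu
    rw [hNdef, det_fromBlocks₁₁, Matrix.invOf_eq_nonsing_inv, det_unique (n := Unit), Matrix.mul_assoc]
    congr 1
  have e1 : M *ᵥ k₁ + k₂ • c = fun _ => 1 := by
    ext i
    have := congrFun hNk (Sum.inl i)
    rw [mulVec, dotProduct, Fintype.sum_sum_type] at this
    simpa [hNdef, mulVec, dotProduct, mul_comm] using this
  have e2 : r ⬝ᵥ k₁ + d * k₂ = 1 := by
    have := congrFun hNk (Sum.inr ())
    rw [mulVec, dotProduct, Fintype.sum_sum_type] at this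
    simpa [hNdef, dotProduct] using this
  have e3 : k₁ = ρ - k₂ • κ := by
    have h := congrArg (fun v => M⁻¹ *ᵥ v) e1
    simp only [mulVec_add, mulVec_mulVec, nonsing_inv_mul _ hMu, one_mulVec, mulVec_smul] at h
    rw [eq_sub_iff_add_eq, h]
    ext i
    simp [hρ, mulVec, dotProduct]
  have e4 : ∑ i, κ i = ∑ i, (∑ j, M⁻¹ j i) * c i := by
    simp only [hκ, mulVec, dotProduct, Finset.sum_mul]
    exact Finset.sum_comm
  have e5 : ∑ i, ∑ j, N⁻¹ i j = ∑ i, ρ i + k₂ * (1 - ∑ i, κ i) := by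
    have : ∀ i, ∑ j, N⁻¹ i j = k i := fun i => by simp [hk, mulVec, dotProduct]
    simp only [this]
    rw [Fintype.sum_sum_type]
    change ∑ i, k₁ i + ∑ _u : Unit, k₂ = _
    rw [e3]
    simp only [Pi.sub_apply, Pi.smul_apply, smul_eq_mul, Finset.sum_sub_distrib, ← Finset.mul_sum]
    simp
    ring
  have e6 : k₂ * (d - r ⬝ᵥ κ) = 1 - r ⬝ᵥ ρ := by
    rw [e3, dotProduct_sub, dotProduct_smul, smul_eq_mul] at e2
    linear_combination e2
  have e7 : ∑ j, (∑ i, M⁻¹ j i) * r j = r ⬝ᵥ ρ := by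
    simp only [dotProduct, hρ, mul_comm]
  rw [sum_adjugate_eq M hM, sum_adjugate_eq N hN, ← e4, e7, e5, hdet]
  linear_combination M.det ^ 2 * (1 - ∑ i, κ i) * e6

theorem map_aeval_adjSum (a : ι → List (Fin q)) (z : K) :
    ∑ i, ∑ j, ((corrMatrix a).map fun f => aeval z f).adjugate i j = aeval z (corrAdjSum a) := by
  have h1 : ((corrMatrix a).map fun f => aeval z f) =
      ((aeval z : ℤ[X] →ₐ[ℤ] K) : ℤ[X] →+* K).mapMatrix (corrMatrix a) := rfl
  rw [h1, ← RingHom.map_adjugate, corrAdjSum]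
  simp only [map_sum]
  rfl

theorem corrDet_adjoin_identity (a : ι → List (Fin q)) (w : List (Fin q)) (z : K)
    (h1 : aeval z (corrDet a) ≠ 0) (h2 : aeval z (corrDet (adjoin a w)) ≠ 0) :
    (aeval z (corrDet a) * aeval z (corrAdjSum (adjoin a w)) -
      aeval z (corrAdjSum a) * aeval z (corrDet (adjoin a w))) / aeval z (corrDet a) ^ 2 =
    (1 - ∑ j, rowSum a j z * aeval z (corr (a j) w)) *
      (1 - ∑ i, colSum a i z * aeval z (corr w (a i))) := by
  rw [← map_aeval_det] at h1 h2
  rw [corrMatrix_adjoin] at h2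
  have h := bordered_adjugate_sum _ _ _ _ h1 h2
  rw [← corrMatrix_adjoin, map_aeval_adjSum, map_aeval_adjSum, map_aeval_det, map_aeval_det] at h
  rw [map_aeval_det] at h1
  rw [h, mul_div_cancel_left₀ _ (pow_ne_zero 2 h1)]
  rfl

end

end

/-! ### Convergence beyond the Perron root, and joinability from irreducibility. -/

section

variable {q : ℕ} {ι : Type*}

section

open Matrix

theorem exists_pos_of_mul_apply_pos {n : Type*} [Fintype n] {A B : Matrix n n ℝ}
    (hA : ∀ i j, 0 ≤ A i j) {i j : n} (h : 0 < (A * B) i j) :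
    ∃ l, 0 < A i l ∧ 0 < B l j := by
  rw [Matrix.mul_apply] at h
  obtain ⟨l, -, hl⟩ := Finset.exists_lt_of_sum_lt (f := fun _ => (0 : ℝ)) (by simpa using h)
  rcases (hA i l).eq_or_lt with h1 | h1
  · simp [← h1] at hl
  · exact ⟨l, h1, pos_of_mul_pos_right hl h1.le⟩

theorem mul_apply_pos {n : Type*} [Fintype n] {A B : Matrix n n ℝ}
    (hA : ∀ i j, 0 ≤ A i j) (hB : ∀ i j, 0 ≤ B i j) {i l j : n} (h₁ : 0 < A i l) (h₂ : 0 < B l j) :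
    0 < (A * B) i j := by
  rw [Matrix.mul_apply]
  exact Finset.sum_pos' (fun l _ => mul_nonneg (hA i l) (hB l j))
    ⟨l, Finset.mem_univ _, mul_pos h₁ h₂⟩

theorem pow_apply_nonneg {n : Type*} [Fintype n] [DecidableEq n] {A : Matrix n n ℝ}
    (hA : ∀ i j, 0 ≤ A i j) (k : ℕ) (i j : n) : 0 ≤ (A ^ k) i j := by
  induction k generalizing i j with
  | zero => rw [pow_zero, one_apply]; split_ifs <;> norm_num
  | succ k ih =>
    rw [pow_succ, Matrix.mul_apply]
    exact Finset.sum_nonneg fun l _ => mul_nonneg (ih i l) (hA l j)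

/-- Closed walks at `j` lengthen a walk at will; long walks are needed to keep its end blocks
disjoint. -/
theorem exists_pow_pos_of_le {n : Type*} [Fintype n] [DecidableEq n] {A : Matrix n n ℝ}
    (hA : A.IsIrreducible) (m : ℕ) (i j : n) : ∃ k, m ≤ k ∧ 0 < (A ^ k) i j := by
  have h0 := hA.nonneg
  have hex := (isIrreducible_iff_exists_pow_pos h0).mp hA
  induction m with
  | zero =>
    obtain ⟨k, -, hk⟩ := hex i j
    exact ⟨k, Nat.zero_le _, hk⟩
  | succ m ih =>
    obtain ⟨k, hk1, hk2⟩ := ih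
    obtain ⟨l, hl1, hl2⟩ := hex j j
    refine ⟨k + l, by omega, ?_⟩
    rw [pow_add]
    exact mul_apply_pos (pow_apply_nonneg h0 k) (pow_apply_nonneg h0 l) hk2 hl2

/-- The powers of a complex matrix are summable against `z ^ (-n)` beyond its spectral radius. -/
theorem summable_pow_entries {n : Type*} [Fintype n] [DecidableEq n] (A : Matrix n n ℝ) {z : ℝ}
    (hz : (spectralRadius ℂ (A.map fun t : ℝ => (t : ℂ))).toReal < z) (i j : n) :
    Summable fun k : ℕ => (A ^ k) i j * z⁻¹ ^ k := by
  let _ : NormedRing (Matrix n n ℂ) := Matrix.linftyOpNormedRing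
  let _ : NormedAlgebra ℂ (Matrix n n ℂ) := Matrix.linftyOpNormedAlgebra
  have _ : CompleteSpace (Matrix n n ℂ) := FiniteDimensional.complete ℂ _
  set B : Matrix n n ℂ := A.map fun t : ℝ => (t : ℂ)
  have hBpow : ∀ k, B ^ k = (A ^ k).map fun t : ℝ => (t : ℂ) := fun k =>
    (Matrix.map_pow A Complex.ofRealHom k).symm
  have hentry : ∀ k, |(A ^ k) i j| ≤ ‖B ^ k‖ := by
    intro k
    have h1 : ‖(B ^ k) i j‖₊ ≤ ‖B ^ k‖₊ := by
      rw [Matrix.linfty_opNNNorm_def]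
      exact (Finset.single_le_sum (f := fun j => ‖(B ^ k) i j‖₊) (fun _ _ => zero_le)
        (Finset.mem_univ j)).trans
          (Finset.le_sup (f := fun i => ∑ j, ‖(B ^ k) i j‖₊) (Finset.mem_univ i))
    have h2 : ‖(B ^ k) i j‖ = |(A ^ k) i j| := by
      rw [hBpow]; simp
    rw [← h2]
    exact h1
  -- Finiteness makes the passage through `toReal` faithful.
  have hfin : spectralRadius ℂ B ≠ ⊤ := by
    refine ne_top_of_le_ne_top ?_ (spectrum.spectralRadius_le_pow_nnnorm_pow_one_div ℂ B 0)
    simp [ENNReal.mul_eq_top]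
  obtain ⟨y, hy1, hy2⟩ := exists_between hz
  have hy0 : 0 ≤ y := ENNReal.toReal_nonneg.trans hy1.le
  have hz0 : 0 < z := hy0.trans_lt hy2
  have hlt : spectralRadius ℂ B < ENNReal.ofReal y := by
    rwa [ENNReal.lt_ofReal_iff_toReal_lt hfin]
  -- Gelfand's formula, with `y` strictly between the spectral radius and `z` so that a geometric
  -- series dominates.
  have hev : ∀ᶠ k : ℕ in atTop, ‖B ^ k‖ ≤ y ^ k := by
    filter_upwards [(spectrum.pow_norm_pow_one_div_tendsto_nhds_spectralRadius B).eventually_lt_const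
      hlt, eventually_gt_atTop 0] with k hk hk0
    have h1 := (ENNReal.ofReal_lt_ofReal_iff_of_nonneg (by positivity)).mp hk
    have h2 := pow_le_pow_left₀ (by positivity) h1.le k
    rwa [← Real.rpow_natCast, ← Real.rpow_mul (norm_nonneg _),
      one_div_mul_cancel (by positivity), Real.rpow_one] at h2
  have hgeom : Summable fun k : ℕ => (y * z⁻¹) ^ k :=
    summable_geometric_of_lt_one (by positivity) (by
      rw [← div_eq_mul_inv, div_lt_one hz0]; exact hy2)
  refine Summable.of_norm_bounded_eventually_nat hgeom ?_
  filter_upwards [hev] with k hk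
  rw [norm_mul, Real.norm_eq_abs, Real.norm_of_nonneg (by positivity : 0 ≤ z⁻¹ ^ k), mul_pow]
  exact mul_le_mul_of_nonneg_right ((hentry k).trans hk) (by positivity)

end

/-- Group the words by length; the shift by `m` drops only finitely many lengths. -/
theorem seriesConverges_of_card (a : ι → List (Fin q)) {z : ℝ} (hz : 0 < z)
    (L : ℕ → Finset (List (Fin q)))
    (hL : ∀ v, Avoids a v → v ∈ L v.length) {m : ℕ}
    (hs : Summable fun n => ((L (n + m)).card : ℝ) * z⁻¹ ^ (n + m)) : SeriesConverges a z := by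
  classical
  have hs' : Summable fun n => ((L n).card : ℝ) * z⁻¹ ^ n :=
    (summable_nat_add_iff (f := fun n => ((L n).card : ℝ) * z⁻¹ ^ n) m).mp hs
  refine summable_of_sum_le (c := ∑' n, ((L n).card : ℝ) * z⁻¹ ^ n)
    (fun v => mul_nonneg (ind_nonneg _) (by positivity)) fun u => ?_
  rw [← Finset.sum_fiberwise_of_maps_to (t := u.image List.length)
    (fun v hv => Finset.mem_image_of_mem _ hv)]
  refine le_trans (Finset.sum_le_sum fun n _ => ?_)
    (hs'.sum_le_tsum (u.image List.length) fun n _ => by positivity)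
  calc ∑ v ∈ u with v.length = n, ind (Avoids a v) * z⁻¹ ^ v.length
      = ∑ v ∈ u with v.length = n, ind (Avoids a v) * z⁻¹ ^ n :=
        Finset.sum_congr rfl fun v hv => by rw [(Finset.mem_filter.mp hv).2]
    _ = (∑ v ∈ u with v.length = n, ind (Avoids a v)) * z⁻¹ ^ n := by rw [Finset.sum_mul]
    _ ≤ _ := by
        refine mul_le_mul_of_nonneg_right ?_ (by positivity)
        unfold ind
        rw [Finset.sum_boole]
        refine Nat.cast_le.mpr (Finset.card_le_card fun v hv => ?_)
        simp only [Finset.mem_filter] at hv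
        rw [← hv.1.2]
        exact hL v hv.2

section

variable {a : ι → List (Fin q)} {p : ℕ}

theorem avoids_iff_isAllowed (hq : 0 < q) (hmin : IsMinimal a) (w : List (Fin q)) :
    Avoids a w ↔ IsAllowed a w := (hmin.isAllowed_iff hq w).symm

theorem exists_extension (hq : 0 < q) (hmin : IsMinimal a) {u : List (Fin q)} (hu : Avoids a u)
    (n : ℕ) : ∃ r : List (Fin q), r.length = n ∧ Avoids a (u ++ r) := by
  obtain ⟨ξ, hξ, k, hk⟩ := (avoids_iff_isAllowed hq hmin u).mp hu
  refine ⟨List.ofFn fun i : Fin n => ξ (k + u.length + i), by simp, ?_⟩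
  refine (avoids_iff_isAllowed hq hmin _).mpr ⟨ξ, hξ, k, fun j => ?_⟩
  rw [List.get_eq_getElem]
  rcases lt_or_ge (j : ℕ) u.length with hj | hj
  · rw [List.getElem_append_left hj]
    exact hk ⟨j, hj⟩
  · rw [List.getElem_append_right hj, List.getElem_ofFn]
    congr 1
    simp only
    omega

theorem adjacencyMatrix_nonneg (x y : AllowedWord a (p - 1)) : 0 ≤ adjacencyMatrix a p x y := by
  rw [adjacencyMatrix, Matrix.of_apply]
  split_ifs <;> norm_num

theorem adjacencyMatrix_pos {x y : AllowedWord a (p - 1)} (h : 0 < adjacencyMatrix a p x y) :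
    ∃ β : Fin q, y.1.toList = x.1.toList.tail ++ [β] ∧ IsAllowed a (x.1.toList ++ [β]) := by
  rw [adjacencyMatrix, Matrix.of_apply] at h
  by_contra hcon
  rw [if_neg hcon] at h
  exact lt_irrefl _ h

open Classical in
-- A positive entry of the power is a walk of `n` steps. Each step appends a letter, and gluing
-- along the current block of `p - 1` letters keeps the word avoiding.
theorem exists_word_of_pow_pos (hq : 0 < q) (hmin : IsMinimal a) (hp : 1 ≤ p)
    (hlen : ∀ i, (a i).length ≤ p)
    (x : AllowedWord a (p - 1)) (n : ℕ) (y : AllowedWord a (p - 1))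
    (h : 0 < (adjacencyMatrix a p ^ n) x y) :
    ∃ r : List (Fin q), r.length = n ∧ Avoids a (x.1.toList ++ r) ∧
      y.1.toList <:+ x.1.toList ++ r := by
  induction n generalizing y with
  | zero =>
    rw [pow_zero, Matrix.one_apply] at h
    split_ifs at h with hxy
    · subst hxy
      exact ⟨[], rfl, by simpa using (avoids_iff_isAllowed hq hmin _).mpr x.2, by simp⟩
    · exact absurd h (lt_irrefl _)
  | succ n ih =>
    rw [pow_succ] at h
    obtain ⟨l, h1, h2⟩ := exists_pos_of_mul_apply_pos
      (pow_apply_nonneg adjacencyMatrix_nonneg n) h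
    obtain ⟨r, hr, hav, s, hs⟩ := ih l h1
    obtain ⟨β, hβ, hall⟩ := adjacencyMatrix_pos h2
    have hglue := Avoids.glue (m := p - 1) (fun i => (hlen i).trans (by omega)) (hs ▸ hav)
      ((avoids_iff_isAllowed hq hmin _).mpr hall) (by simp)
    rw [hs, List.append_assoc] at hglue
    refine ⟨r ++ [β], by simp [hr], hglue, ?_⟩
    rw [hβ, ← List.append_assoc, ← hs]
    obtain ⟨t, ht⟩ := List.tail_suffix l.1.toList
    exact ⟨s ++ t, by simp only [List.append_assoc, List.append_cancel_left_eq]; rw [← List.append_assoc, ht]⟩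

theorem joinable_of_isIrreducible (hq : 0 < q) (hmin : IsMinimal a) (hp : 1 ≤ p)
    (hlen : ∀ i, (a i).length ≤ p) (hirr : (adjacencyMatrix a p).IsIrreducible) :
    Joinable a := by
  classical
  intro u v hu hv
  have hlen' : ∀ i, (a i).length ≤ p - 1 + 1 := fun i => (hlen i).trans (by omega)
  obtain ⟨r, hr, hur⟩ := exists_extension hq hmin hu (p - 1)
  obtain ⟨r', hr', hvr⟩ := exists_extension hq hmin hv (p - 1)
  obtain ⟨s, y, hsy, hyl⟩ : ∃ s y, s ++ y = u ++ r ∧ y.length = p - 1 :=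
    ⟨u, r, rfl, hr⟩
  obtain ⟨x, t, hxt, hxl⟩ : ∃ x t, x ++ t = v ++ r' ∧ x.length = p - 1 :=
    ⟨_, _, List.take_append_drop (p - 1) (v ++ r'), by simp [hr']⟩
  have hxa : Avoids a x := hvr.of_infix (hxt ▸ List.infix_append_left)
  have hya : Avoids a y := hur.of_infix (hsy ▸ List.infix_append_right)
  let X : AllowedWord a (p - 1) := ⟨⟨x, hxl⟩, (avoids_iff_isAllowed hq hmin _).mp hxa⟩
  let Y : AllowedWord a (p - 1) := ⟨⟨y, hyl⟩, (avoids_iff_isAllowed hq hmin _).mp hya⟩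
  -- At least `p - 1` steps ensure that the final block `x` lies wholly in the appended letters, so
  -- that the walk reads `y ++ e ++ x`.
  obtain ⟨k, hk1, hk2⟩ := exists_pow_pos_of_le hirr (p - 1) Y X
  obtain ⟨r₂, h1, h2, h3⟩ := exists_word_of_pow_pos hq hmin hp hlen Y k X hk2
  change Avoids a (y ++ r₂) at h2
  change x <:+ y ++ r₂ at h3
  obtain ⟨e, rfl⟩ := List.suffix_of_suffix_length_le h3 (List.suffix_append y r₂) (by omega)
  have h4 := Avoids.glue hlen' (hsy ▸ hur) h2 hyl.ge
  rw [← List.append_assoc] at h4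
  have h5 := Avoids.glue hlen' h4 (hxt ▸ hvr) hxl.ge
  rw [hsy, List.append_assoc, hxt] at h5
  refine ⟨r ++ e, h5.of_infix ⟨[], r', by simp⟩⟩

open Classical in
/-- The avoiding words of length `n + (p - 1)` that start with `x`. -/
noncomputable def wordsFrom (a : ι → List (Fin q)) (p n : ℕ) (x : List (Fin q)) :
    Finset (List (Fin q)) :=
  (List.finite_length_eq (Fin q) (n + (p - 1))).toFinset.filter fun v => Avoids a v ∧ x <+: v

theorem mem_wordsFrom {n : ℕ} {x v : List (Fin q)} :
    v ∈ wordsFrom a p n x ↔ v.length = n + (p - 1) ∧ Avoids a v ∧ x <+: v := by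
  simp [wordsFrom]

open Classical in
-- Deleting the first letter of a word counted at `n + 1` leaves one counted at `n` from a successor
-- block of `x`.
theorem card_wordsFrom_le (hq : 0 < q) (hmin : IsMinimal a) (hp : 2 ≤ p) (n : ℕ)
    (x : AllowedWord a (p - 1)) :
    ((wordsFrom a p n x.1.toList).card : ℝ) ≤ ∑ y, (adjacencyMatrix a p ^ n) x y := by
  induction n generalizing x with
  | zero =>
    have h1 : wordsFrom a p 0 x.1.toList ⊆ {x.1.toList} := by
      intro v hv
      obtain ⟨h1, -, h2⟩ := mem_wordsFrom.mp hv
      rw [Finset.mem_singleton]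
      exact (h2.eq_of_length (by simp [h1])).symm
    have h2 := Finset.card_le_card h1
    simp only [Finset.card_singleton] at h2
    simp only [pow_zero, Matrix.one_apply, Finset.sum_ite_eq, Finset.mem_univ, if_true]
    exact_mod_cast h2
  | succ n ih =>
    have hsub : wordsFrom a p (n + 1) x.1.toList ⊆ Finset.univ.biUnion
        fun y : AllowedWord a (p - 1) => if adjacencyMatrix a p x y = 1 then
          (wordsFrom a p n y.1.toList).image fun v => x.1.toList.take 1 ++ v else ∅ := by
      intro v hv
      obtain ⟨h1, h2, h3⟩ := mem_wordsFrom.mp hv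
      have hxl : x.1.toList.length = p - 1 := by simp
      obtain ⟨c, x', hx⟩ : ∃ c x', x.1.toList = c :: x' :=
        List.exists_cons_of_length_pos (by omega)
      rw [hx] at h3
      obtain ⟨t, rfl⟩ := h3
      rw [hx, List.length_cons] at hxl
      cases t with
      | nil => simp at h1; omega
      | cons β t =>
        have hya : Avoids a (c :: (x' ++ [β])) := h2.of_infix ⟨[], t, by simp⟩
        let Y : AllowedWord a (p - 1) := ⟨⟨x' ++ [β], by simp [hxl]⟩,
          (avoids_iff_isAllowed hq hmin _).mp (hya.of_infix (List.suffix_cons _ _).isInfix)⟩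
        have hA : adjacencyMatrix a p x Y = 1 := by
          rw [adjacencyMatrix, Matrix.of_apply, if_pos]
          refine ⟨β, ?_, (avoids_iff_isAllowed hq hmin _).mp ?_⟩
          · rw [hx]; rfl
          · rw [hx]; exact hya
        rw [Finset.mem_biUnion]
        refine ⟨Y, Finset.mem_univ _, ?_⟩
        rw [if_pos hA, Finset.mem_image]
        refine ⟨x' ++ β :: t, mem_wordsFrom.mpr ⟨?_, ?_, ?_⟩, by rw [hx]; rfl⟩
        · simp at h1 ⊢; omega
        · exact h2.of_infix (List.suffix_cons _ _).isInfix
        · exact ⟨t, by change x' ++ [β] ++ t = _; simp⟩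
    have h1 := (Finset.card_le_card hsub).trans Finset.card_biUnion_le
    have h2 : ((wordsFrom a p (n + 1) x.1.toList).card : ℝ) ≤
        ∑ y : AllowedWord a (p - 1), adjacencyMatrix a p x y *
          ((wordsFrom a p n y.1.toList).card : ℝ) := by
      refine (Nat.cast_le.mpr h1).trans ?_
      rw [Nat.cast_sum]
      refine Finset.sum_le_sum fun y _ => ?_
      split_ifs with hA
      · rw [hA, one_mul]
        exact Nat.cast_le.mpr Finset.card_image_le
      · simp only [Finset.card_empty, Nat.cast_zero]
        exact mul_nonneg (adjacencyMatrix_nonneg x y) (Nat.cast_nonneg _)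
    refine h2.trans ?_
    simp only [pow_succ', Matrix.mul_apply]
    rw [Finset.sum_comm]
    simp only [← Finset.mul_sum]
    exact Finset.sum_le_sum fun y _ => mul_le_mul_of_nonneg_left (ih y) (adjacencyMatrix_nonneg x y)

/-- Sorting avoiding words of length `n + (p - 1)` by their first `p - 1` letters bounds their
number by the sum of the entries of the `n`-th power of the adjacency matrix. -/
theorem seriesConverges_of_perronRoot_lt (hq : 0 < q) (hmin : IsMinimal a) (hp : 2 ≤ p) {z : ℝ}
    (hz : perronRoot a p < z) : SeriesConverges a z := by
  classical
  have hz0 : 0 < z := ENNReal.toReal_nonneg.trans_lt hz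
  refine seriesConverges_of_card a hz0
    (fun n => (List.finite_length_eq (Fin q) n).toFinset.filter fun v => Avoids a v)
    (fun v hv => by simpa using hv) (m := p - 1) ?_
  have hs : Summable fun n : ℕ =>
      ∑ x, ∑ y, z⁻¹ ^ (p - 1) * ((adjacencyMatrix a p ^ n) x y * z⁻¹ ^ n) :=
    summable_sum fun x _ => summable_sum fun y _ =>
      (summable_pow_entries (adjacencyMatrix a p) hz x y).mul_left _
  refine Summable.of_nonneg_of_le (fun n => by positivity) (fun n => ?_) hs
  have hsub : ((List.finite_length_eq (Fin q) (n + (p - 1))).toFinset.filter fun v => Avoids a v) ⊆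
      Finset.univ.biUnion fun x : AllowedWord a (p - 1) => wordsFrom a p n x.1.toList := by
    intro v hv
    simp only [Finset.mem_filter, Set.Finite.mem_toFinset, Set.mem_ofPred_eq] at hv
    rw [Finset.mem_biUnion]
    refine ⟨⟨⟨v.take (p - 1), by simp [hv.1]⟩, (avoids_iff_isAllowed hq hmin _).mp
      (hv.2.of_infix (List.take_prefix _ _).isInfix)⟩, Finset.mem_univ _, ?_⟩
    exact mem_wordsFrom.mpr ⟨hv.1, hv.2, List.take_prefix _ _⟩
  have h1 := (Finset.card_le_card hsub).trans Finset.card_biUnion_le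
  have h2 : ((((List.finite_length_eq (Fin q) (n + (p - 1))).toFinset.filter
      fun v => Avoids a v).card : ℕ) : ℝ) ≤ ∑ x, ∑ y, (adjacencyMatrix a p ^ n) x y := by
    refine (Nat.cast_le.mpr h1).trans ?_
    rw [Nat.cast_sum]
    exact Finset.sum_le_sum fun x _ => card_wordsFrom_le hq hmin hp n x
  refine (mul_le_mul_of_nonneg_right h2 (by positivity)).trans (le_of_eq ?_)
  simp only [Finset.sum_mul, pow_add]
  refine Finset.sum_congr rfl fun x _ => Finset.sum_congr rfl fun y _ => by ring

end

end

/-! ### Reducing correlations with `w` to its end blocks. -/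

section

variable {q : ℕ} {ι : Type*} {a : ι → List (Fin q)} {p : ℕ}

/-- Removing the first letter of `a i` loses only the overlap by all of `a i`, absent because `x`
avoids it. The tail has at most `p - 1` letters, so `x` cannot end strictly inside it. -/
theorem corr_tail_eq_overlap (hne : ∀ i, a i ≠ []) (hlen : ∀ i, (a i).length ≤ p) {x : List (Fin q)}
    (hx : Avoids a x) (hxl : x.length = p - 1) (i : ι) :
    corr (a i).tail x = overlap (a i) x := by
  have hl := hlen i
  rw [corr_eq_overlap fun l h => ?_, overlap_eq, overlap_eq]
  · refine Finset.sum_congr rfl fun k _ => if_congr ?_ rfl rfl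
    refine ⟨fun h => h.trans (List.tail_suffix _), fun h => ?_⟩
    obtain ⟨c, t, hct⟩ := List.exists_cons_of_ne_nil (hne i)
    rw [hct] at h
    rcases List.suffix_cons_iff.mp h with h' | h'
    · exact absurd (hct ▸ h' ▸ (List.take_prefix _ _).isInfix) (hx i)
    · rwa [hct]
  · have h1 := h.length_le
    rw [h.eq_of_length_le (by simp; omega)]

theorem corr_eq_overlap_of_avoids {x : List (Fin q)} (hx : Avoids a x) (i : ι) :
    corr x (a i) = overlap x (a i) :=
  corr_eq_overlap fun l h => absurd (h.isInfix.trans (List.drop_suffix l x).isInfix) (hx i)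

theorem corr_eq_overlap_of_length_le (hlen : ∀ i, (a i).length ≤ p) {w : List (Fin q)}
    (hw : p ≤ w.length) (i : ι) : corr (a i) w = overlap (a i) w := by
  have hl := hlen i
  refine corr_eq_overlap fun l h => ?_
  rw [h.eq_of_length_le (by simp; omega)]

/-- Since `w` avoids `a i`, only proper suffixes of `a i` can be prefixes of `w`, and these have at
most `p - 1` letters. -/
theorem overlap_eq_of_prefix (hlen : ∀ i, (a i).length ≤ p) {w x : List (Fin q)}
    (hw : Avoids a w) (hxw : x <+: w) (hxl : x.length = p - 1) (i : ι) :
    overlap (a i) w = overlap (a i) x := by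
  have hlen := hlen i
  refine overlap_congr_right fun l _ => ⟨fun h => ?_, fun h => h.trans hxw⟩
  rcases Nat.eq_zero_or_pos l with rfl | hl
  · exact absurd h.isInfix (by simpa using hw i)
  · exact List.prefix_of_prefix_length_le h hxw (by simp; omega)

theorem overlap_eq_of_suffix (hlen : ∀ i, (a i).length ≤ p) {w y : List (Fin q)}
    (hw : Avoids a w) (hyw : y <:+ w) (hyl : y.length = p - 1) (i : ι) :
    overlap w (a i) = overlap y (a i) := by
  rw [← overlap_reverse, ← overlap_reverse y]
  exact overlap_eq_of_prefix (a := fun i => (a i).reverse) (p := p) (by simpa using hlen)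
    (avoids_reverse.mpr (by simpa using hw)) (List.reverse_prefix.mpr hyw) (by simpa using hyl) i

theorem antichain_of_isMinimal (hmin : IsMinimal a) (i j : ι) (h : a i <:+: a j) : i = j := by
  by_contra hij
  obtain ⟨ξ, hξ, hk⟩ := hmin.allowed_of_proper_subword j (a i) h
    fun h' => hij (hmin.injective h')
  exact hξ i hk

/-- Makes `corrDet_ne_zero` applicable to the family extended by `w`. -/
theorem antichain_adjoin (hanti : ∀ i j, a i <:+: a j → i = j) (hlen : ∀ i, (a i).length ≤ p)
    {w : List (Fin q)} (hw : Avoids a w) (hwl : p ≤ w.length) (i j : ι ⊕ Unit)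
    (h : adjoin a w i <:+: adjoin a w j) : i = j := by
  rcases i with i | i <;> rcases j with j | j
  · rw [hanti i j h]
  · exact absurd h (hw i)
  · have h' : w <:+: a j := h
    have h1 : w = a j := h'.eq_of_length_le ((hlen j).trans hwl)
    exact absurd (h1 ▸ List.infix_rfl) (hw j)
  · rfl

end

end ForbiddenWords

/-! ### Assembly of the theorem. -/

theorem lemma5p5 {q s p : ℕ} (hq : 2 ≤ q) (a : Fin s → List (Fin q))
    (hmin : IsMinimal a)
    (hp : IsGreatest (Set.range fun i => (a i).length) p)
    (hirr : (adjacencyMatrix a p).IsIrreducible)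
    (θ : ℝ) (hθ : θ = perronRoot a p) :
    (∀ i, Tendsto (fun z : ℂ => rowSum a i z) (𝓝[≠] (θ : ℂ)) (𝓝 (rowSumLim a θ i : ℂ))) ∧
    (∀ j, Tendsto (fun z : ℂ => colSum a j z) (𝓝[≠] (θ : ℂ)) (𝓝 (colSumLim a θ j : ℂ))) ∧
    (∀ w x y : List (Fin q), IsAllowed a w → p ≤ w.length →
      x.length = p - 1 → x <+: w → y.length = p - 1 → y <:+ w →
      Tendsto (fun z : ℂ =>
          (aeval z (corrDet a) * aeval z (corrAdjSum (adjoin a w)) -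
            aeval z (corrAdjSum a) * aeval z (corrDet (adjoin a w))) /
              aeval z (corrDet a) ^ 2)
        (𝓝[≠] (θ : ℂ)) (𝓝 ((uVec a θ x * vVec a θ y : ℝ) : ℂ)) ∧
      0 < uVec a θ x * vVec a θ y) ∧
    ((∀ x : AllowedWord a (p - 1), 0 < uVec a θ x.1.toList ∧ 0 < vVec a θ x.1.toList) ∨
      (∀ x : AllowedWord a (p - 1), uVec a θ x.1.toList < 0 ∧ vVec a θ x.1.toList < 0)) ∧
    (∀ x : AllowedWord a (p - 1), 0 < uVec a θ x.1.toList * vVec a θ x.1.toList) := by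
  have hq0 : 0 < q := by omega
  have hlen : ∀ i, (a i).length ≤ p := fun i => hp.2 ⟨i, rfl⟩
  have hp2 : 2 ≤ p := by
    obtain ⟨i, hi⟩ := hp.1
    exact hi ▸ hmin.two_le_length i
  have hlen' : ∀ i, (a i).length ≤ p - 1 + 1 := fun i => (hlen i).trans (by omega)
  have hne : ∀ i, a i ≠ [] := fun i h => by
    have := hmin.two_le_length i
    simp [h] at this
  have hanti := antichain_of_isMinimal hmin
  have hav := avoids_iff_isAllowed hq0 hmin
  have hθ0 : 0 ≤ θ := hθ ▸ ENNReal.toReal_nonneg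
  have hjoin := joinable_of_isIrreducible hq0 hmin (by omega) hlen hirr
  have hconv : ∀ z, θ < z → SeriesConverges a z := fun z hz =>
    seriesConverges_of_perronRoot_lt hq0 hmin hp2 (hθ ▸ hz)
  obtain ⟨R, hR, hR', hRpos⟩ := exists_rowSum_limit hanti hne hlen' hjoin hθ0 hconv
  -- Column sums of `𝓜⁻¹` are row sums for the reversed words, so the same result applies.
  obtain ⟨C, hC, hC', hCpos⟩ := exists_rowSum_limit (a := fun i => (a i).reverse) (m := p - 1)
    (antichain_reverse hanti) (by simpa using hne) (by simpa using hlen') hjoin.reverse hθ0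
    fun z hz => (hconv z hz).reverse
  simp only [rowSum_reverse hanti] at hC hC'
  have hRlim : ∀ i, rowSumLim a θ i = R i := fun i => (hR' i).limUnder_eq
  have hClim : ∀ i, colSumLim a θ i = C i := fun i => (hC' i).limUnder_eq
  have hu : ∀ x : List (Fin q), Avoids a x → x.length = p - 1 →
      uVec a θ x = 1 - ∑ i, R i * aeval θ (overlap (a i) x) := fun x hx hxl => by
    simp only [uVec, hRlim, corr_tail_eq_overlap hne hlen hx hxl]
  have hv : ∀ x : List (Fin q), Avoids a x →
      vVec a θ x = 1 - ∑ i, C i * aeval θ (overlap x (a i)) := fun x hx => by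
    simp only [vVec, hClim, corr_eq_overlap_of_avoids hx]
  have hupos : ∀ x : List (Fin q), Avoids a x → x.length = p - 1 → 0 < uVec a θ x :=
    fun x hx hxl => hu x hx hxl ▸ hRpos x hx
  have hvpos : ∀ x : List (Fin q), Avoids a x → 0 < vVec a θ x := fun x hx => by
    have h := hCpos x.reverse (avoids_reverse.mpr (by simpa using hx))
    simp only [overlap_reverse] at h
    rwa [hv x hx]
  have hword : ∀ x : AllowedWord a (p - 1), 0 < uVec a θ x.1.toList ∧ 0 < vVec a θ x.1.toList :=
    fun x => ⟨hupos _ ((hav _).mpr x.2) (by simp), hvpos _ ((hav _).mpr x.2)⟩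
  refine ⟨fun i => hRlim i ▸ hR i, fun j => hClim j ▸ hC j, ?_, Or.inl hword,
    fun x => mul_pos (hword x).1 (hword x).2⟩
  intro w x y hw hwl hxl hxw hyl hyw
  have hwa := (hav w).mpr hw
  have hxa : Avoids a x := hwa.of_infix hxw.isInfix
  have hya : Avoids a y := hwa.of_infix hyw.isInfix
  refine ⟨?_, mul_pos (hupos x hxa hxl) (hvpos y hya)⟩
  have hpoly : ∀ f : ℤ[X], Tendsto (fun z : ℂ => aeval z f) (𝓝[≠] (θ : ℂ))
      (𝓝 ((aeval θ f : ℝ) : ℂ)) := fun f => by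
    have h : aeval (θ : ℂ) f = ((aeval θ f : ℝ) : ℂ) := aeval_algebraMap_apply ℂ θ f
    rw [← h]
    exact (f.continuous_aeval.tendsto _).mono_left nhdsWithin_le_nhds
  have hlim : Tendsto (fun z : ℂ => (1 - ∑ j, rowSum a j z * aeval z (overlap (a j) x)) *
      (1 - ∑ i, colSum a i z * aeval z (overlap y (a i)))) (𝓝[≠] (θ : ℂ))
      (𝓝 ((uVec a θ x * vVec a θ y : ℝ) : ℂ)) := by
    rw [hu x hxa hxl, hv y hya]
    push_cast
    exact (tendsto_const_nhds.sub (tendsto_finsetSum _ fun i _ => (hR i).mul (hpoly _))).mul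
      (tendsto_const_nhds.sub (tendsto_finsetSum _ fun i _ => (hC i).mul (hpoly _)))
  -- The factorization is needed only near `θ`, off `θ`, where both determinants are nonzero; either
  -- may vanish at `θ`.
  refine hlim.congr' ?_
  have hanti' := antichain_adjoin hanti hlen hwa hwl
  have hne' : ∀ i, adjoin a w i ≠ [] := by
    rintro (i | i)
    · exact hne i
    · intro h
      have : w = [] := h
      simp [this] at hwl
      omega
  filter_upwards [eventually_aeval_ne_zero (corrDet_ne_zero hanti hne) (θ : ℂ),
    eventually_aeval_ne_zero (corrDet_ne_zero hanti' hne') (θ : ℂ)] with z h1 h2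
  rw [corrDet_adjoin_identity a w z h1 h2]
  simp only [corr_eq_overlap_of_length_le hlen hwl, corr_eq_overlap_of_avoids hwa,
    overlap_eq_of_prefix hlen hwa hxw hxl, overlap_eq_of_suffix hlen hwa hyw hyl]
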